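/- Let $G$ be a finite simple graph on $n\ge 1$ vertices with maximal degree $d$, let $\Gamma$ be a locally finite vertex-transitive graph with a vertex $o$, and let $p\in[0,1]$. For a graph $H$, $\mathrm{perc}(H,p)$ is the random graph on the vertices of $H$ obtained by keeping each edge of $H$ independently with probability $p$. For a finite graph $H$, $\mu_H$ is the empirical measure (uniform over the eigenvalues, counted with multiplicity) of its adjacency matrix. For a locally finite graph $H$ of bounded degree with adjacency operator $A$ and a vertex $x$, $\mu_H^{e_x}$ is the unique probability measure on $\mathbb R$ with $\int \lambda^j\,d\mu_H^{e_x}(\lambda)=\langle e_x,A^je_x\rangle$ for all $j\ge 0$. Let $\mu=\mathbb E\,\mu^{e_o}_{\mathrm{perc}(\Gamma,p)}$, which is a probability measure. For an integer $h\ge1$ let $B_\Gamma(h)$ be the number of vertices $v$ of $G$ such that the subgraph of $G$ spanned by the vertices at distance at most $h$ from $v$, rooted at $v$, is not isomorphic as a rooted graph to the corresponding subgraph of $\Gamma$ rooted at $o$. Let $1\le k\le 2h$, let $\varphi:\mathbb R\to\mathbb R$ be a $C^k$ function with $\varphi'\in L^1(\mathbb R)$, put $\|\varphi\|_{TV}=\int_{\mathbb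 R}|\varphi'(x)|\,dx$, and let $\|\cdot\|_\infty$ be the supremum norm on $\mathbb R$ (possibly $+\infty$, with $0\cdot\infty=0$). Then for every $t\ge0$, with probability at least $$1-2\exp\!\left(-\frac{n t^2}{8\|\varphi\|_{TV}^2}\right)$$ (with probability $1$ if $\|\varphi\|_{TV}=0$), $$\left|\int\varphi\,d\mu_{\mathrm{perc}(G,p)}-\int\varphi\,d\mu\right|\le t+2\,\frac{B_\Gamma(h)}{n}\|\varphi\|_\infty+2\left(\frac{\pi}{2}d\right)^k\frac{(2h-k+1)!}{(2h+1)!}\,\|\varphi^{(k)}\|_\infty .$$ -/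

import Mathlib

open MeasureTheory ProbabilityTheory
open scoped ENNReal

namespace QuantumPercolation

noncomputable section

/-! ### Adjacency operators and spectral measures -/

/-- The adjacency operator of a locally finite graph `H`, acting on the space `V →₀ ℂ` of finitely
supported functions (its domain in `ℓ²(V)`) by `A e_x = ∑_{y ~ x} e_y`. -/
def adjOperator {V : Type*} (H : SimpleGraph V) [H.LocallyFinite] : Module.End ℂ (V →₀ ℂ) :=
  Finsupp.linearCombination ℂ fun x : V => ∑ y ∈ H.neighborFinset x, Finsupp.single y (1 : ℂ)

/-- `μ` is a probability measure on `ℝ`, with all moments finite, such that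
`∫ x ^ k dμ = ⟨e_x, A ^ k e_x⟩` for all `k`; the inner product with `e_x` is the coordinate at
`x`. -/
def IsSpectralMeasure {V : Type*} (H : SimpleGraph V) [H.LocallyFinite] (x : V)
    (μ : Measure ℝ) : Prop :=
  IsProbabilityMeasure μ ∧ ∀ k : ℕ, Integrable (fun s : ℝ => s ^ k) μ ∧
    ((∫ s : ℝ, s ^ k ∂μ : ℝ) : ℂ) = (adjOperator H ^ k) (Finsupp.single x 1) x

open Classical in
/-- The spectral measure of `H` at the vertex `x`: the unique probability measure on `ℝ` whose
`k`-th moment is `⟨e_x, A ^ k e_x⟩` for all `k` (there is exactly one when the degrees of `H` are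
bounded; the value `0` is used if there is none or more than one). -/
def spectralMeasure {V : Type*} (H : SimpleGraph V) [H.LocallyFinite] (x : V) : Measure ℝ :=
  if hμ : ∃! μ : Measure ℝ, IsSpectralMeasure H x μ then hμ.choose else 0

open Classical in
/-- The empirical measure `(1 / n) ∑ δ_{λ_k}` of the eigenvalues, with multiplicity, of the
adjacency matrix of a finite graph. -/
def empiricalSpectralMeasure {V : Type*} [Fintype V] (H : SimpleGraph V) : Measure ℝ :=
  (Fintype.card V : ℝ≥0∞)⁻¹ •
    ∑ i : V, Measure.dirac ((H.isHermitian_adjMatrix ℂ).eigenvalues i)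

/-! ### Bond percolation -/

/-- The subgraph of `G` on the same vertices whose edges are the edges `e` of `G` which are open
in the configuration `ω`, that is `ω e = true`. -/
def perc {V : Type*} (G : SimpleGraph V) (ω : G.edgeSet → Bool) : SimpleGraph V where
  Adj x y := ∃ hxy : s(x, y) ∈ G.edgeSet, ω ⟨s(x, y), hxy⟩ = true
  symm := ⟨fun x y ⟨hxy, hω⟩ => by
    have he : s(y, x) = s(x, y) := Sym2.eq_swap
    refine ⟨he ▸ hxy, ?_⟩
    simpa only [he] using hω⟩
  loopless := ⟨fun x ⟨hx, _⟩ => G.loopless.irrefl x hx⟩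

instance {V : Type*} (G : SimpleGraph V) [G.LocallyFinite] (ω : G.edgeSet → Bool) :
    (perc G ω).LocallyFinite := fun x =>
  ((Set.toFinite (G.neighborSet x)).subset fun _ hy => hy.1).fintype

/-- The law of the configuration of open edges: the edges of `G` are open independently with
probability `p` each. -/
def percMeasure {V : Type*} (G : SimpleGraph V) (p : unitInterval) :
    Measure (G.edgeSet → Bool) :=
  Measure.infinitePi fun _ : G.edgeSet => bernoulliMeasure true false p

/-- The expected spectral measure `B ↦ 𝔼 [μ_{perc(Γ, p)}^{e_o}(B)]` of the percolation on `Γ` at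
the vertex `o`. -/
def expectedSpectralMeasure {W : Type*} (Γ : SimpleGraph W) [Γ.LocallyFinite] (p : unitInterval)
    (o : W) : Measure ℝ :=
  (percMeasure Γ p).bind fun ω => spectralMeasure (perc Γ ω) o

/-! ### Comparison of graphs -/

/-- Any vertex can be mapped to any other one by an automorphism of the graph. -/
def IsVertexTransitive {W : Type*} (Γ : SimpleGraph W) : Prop :=
  ∀ x y : W, ∃ f : Γ ≃g Γ, f x = y

/-- The set of vertices at graph distance at most `h` from `v` (vertices in other connected
components are at infinite distance). -/
def ballSet {V : Type*} (G : SimpleGraph V) (v : V) (h : ℕ) : Set V :=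
  {x | G.edist v x ≤ h}

theorem mem_ballSet_self {V : Type*} (G : SimpleGraph V) (v : V) (h : ℕ) :
    v ∈ ballSet G v h := by
  simp [ballSet]

/-- The rooted graphs `(G, v)_h` and `(Γ, o)_h`, spanned by the vertices at distance at most `h`
from the root, are isomorphic by an isomorphism which maps root to root. -/
def RootedBallIso {V W : Type*} (G : SimpleGraph V) (v : V) (Γ : SimpleGraph W) (o : W) (h : ℕ) :
    Prop :=
  ∃ f : G.induce (ballSet G v h) ≃g Γ.induce (ballSet Γ o h),
    f ⟨v, mem_ballSet_self G v h⟩ = ⟨o, mem_ballSet_self Γ o h⟩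

/-- The number of vertices `v` of `G` such that `(G, v)_h` is not isomorphic to `(Γ, o)_h`. -/
def badCount {V W : Type*} (G : SimpleGraph V) (Γ : SimpleGraph W) (o : W) (h : ℕ) : ℕ :=
  {v : V | ¬ RootedBallIso G v Γ o h}.ncard

/-! ### Norms of test functions -/

/-- The supremum norm, with value `∞` for unbounded functions. -/
def supNorm (f : ℝ → ℝ) : ℝ≥0∞ := ⨆ x : ℝ, ‖f x‖ₑ

/-- The total variation norm `∫ |φ'(x)| dx` of a function with integrable derivative. -/
def tvNorm (φ : ℝ → ℝ) : ℝ := ∫ x : ℝ, |deriv φ x|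

end

end QuantumPercolation

/-! # Local approximation of the spectrum of percolation graphs

Write `F ω = ∫ φ dμ_{perc(G, p)}`. The theorem combines a concentration bound for `F` around its
mean with a comparison of this mean with `∫ φ dμ`.

*Concentration.* Changing the edges at one vertex `v` does not change the quadratic form of the
adjacency matrix on the hyperplane `u v = 0`; counting dimensions, the number of eigenvalues below
any level changes by at most one (`card_eigenvalues_lt_le`), and `F` changes by at most
`‖φ‖_TV / n` (`abs_integral_empirical_sub_le`). Attributing every edge to one of its endpoints
makes `F` a function of `n` independent blocks, to which the method of bounded differences applies
(`measureReal_abs_sub_le_of_bounded_differences`). It gives the exponent `n t² / (2 ‖φ‖_TV²)`, which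
is better than the one claimed.

*Comparison of the means.* The empirical measure is the average of the spectral measures at the
vertices. Moments of a spectral measure count closed walks, and a closed walk of length at most
`2 h` stays in the ball of radius `h` (`walkCount_embedding`). Where the balls of `G` and `Γ` are
isomorphic, the expected moments up to order `2 h` therefore agree
(`RootedBallIso.integral_walkCount_eq`), and both measures live on `[-d, d]`; so the integrals of
`φ` differ by at most twice the distance of `φ` to the polynomials of degree at most `2 h`. At
the remaining vertices the trivial bound `2 ‖φ‖_∞` is used. If no ball of `G` is isomorphic to that
of `Γ`, the degree of `Γ` may exceed `d`, but then the trivial bound is the only one needed.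

*Polynomial approximation.* The distance to polynomials is bounded by Jackson's theorem with the
sharp constant `π / 2` of Favard (`exists_polynomial_near_of_iteratedDeriv_le`). For one derivative,
`φ (d cos θ)` is written as the convolution of its derivative with the sawtooth `x`, which is
replaced by the sine polynomial of degree `n` interpolating it at the points `j π / (n + 1)`. By
Rolle's theorem their difference changes sign exactly there, so that its `L¹` norm can be computed:
the sign function is orthogonal to all sine polynomials of degree at most `n`. The case of `k`
derivatives follows by induction.

*The limit object.* For a graph of bounded degree, existence of the spectral measure follows from
the finite case by compactness (`existsUnique_isSpectralMeasure`), and uniqueness from the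
Weierstrass theorem. Measurability of the spectral measure of the percolation in the configuration
is inherited from that of its moments (`measurable_of_measurable_moments`).
-/

namespace QuantumPercolation

/-! ### Polynomial approximation with Favard's constant -/

/-- Every polynomial of degree less than `n` is a combination of the Chebyshev polynomials of the
second kind `U_0, …, U_{n-1}`. -/
theorem exists_eq_sum_chebyshevU {n : ℕ} {q : Polynomial ℝ} (hq : q.degree < n) :
    ∃ a : ℕ → ℝ, q = ∑ k ∈ Finset.range n, a k • Polynomial.Chebyshev.U ℝ (k : ℤ) := by
  let S : Polynomial.Sequence ℝ :=
    ⟨fun k => Polynomial.Chebyshev.U ℝ (k : ℤ), fun k =>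
      Polynomial.Chebyshev.degree_U_natCast ℝ k⟩
  have hmem : q ∈ Polynomial.degreeLT ℝ n := by rwa [Polynomial.mem_degreeLT]
  have hu : ∀ i, IsUnit (S i).leadingCoeff := by
    intro i
    change IsUnit (Polynomial.Chebyshev.U ℝ (i : ℤ)).leadingCoeff
    rw [Polynomial.Chebyshev.leadingCoeff_U_natCast]
    exact IsUnit.mk0 _ (by positivity)
  rw [← Polynomial.Sequence.span_degreeLT S (fun i _ => hu i),
    show Set.Iio n = Finset.range n by simp,
    Submodule.mem_span_image_finset_iff_exists_fun'] at hmem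
  obtain ⟨c, rfl⟩ := hmem
  exact ⟨c, rfl⟩

/-- There is a sine polynomial of degree at most `n` which agrees with `x` at the points
`j π / (n + 1)`, `0 ≤ j ≤ n`. -/
theorem exists_sine_interpolation (n : ℕ) :
    ∃ a : ℕ → ℝ, ∀ j ≤ n,
      ∑ k ∈ Finset.range n, a k * Real.sin ((k + 1) * (j * (Real.pi / (n + 1)))) =
        j * (Real.pi / (n + 1)) := by
  have hα : 0 < Real.pi / (n + 1) := by positivity
  have hlt : ∀ j : ℕ, j ≤ n → (j : ℝ) * (Real.pi / (n + 1)) < Real.pi := by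
    intro j hj
    have h1 : (j : ℝ) < n + 1 := by exact_mod_cast Nat.lt_succ_of_le hj
    calc (j : ℝ) * (Real.pi / (n + 1)) < (n + 1) * (Real.pi / (n + 1)) := by gcongr
      _ = Real.pi := by field_simp
  let s : Finset ℕ := Finset.Ico 1 (n + 1)
  have hinj : Set.InjOn (fun j : ℕ => Real.cos (j * (Real.pi / (n + 1)))) s := by
    intro i hi j hj hij
    simp only [s, Finset.coe_Ico, Set.mem_Ico] at hi hj
    have := Real.injOn_cos ⟨by positivity, (hlt i (by omega)).le⟩
      ⟨by positivity, (hlt j (by omega)).le⟩ hij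
    exact_mod_cast mul_right_cancel₀ hα.ne' this
  let r : ℕ → ℝ := fun j =>
    j * (Real.pi / (n + 1)) / Real.sin (j * (Real.pi / (n + 1)))
  obtain ⟨a, ha⟩ := exists_eq_sum_chebyshevU (n := n)
    (q := Lagrange.interpolate s (fun j : ℕ => Real.cos (j * (Real.pi / (n + 1)))) r) (by
      simpa [s] using Lagrange.degree_interpolate_lt r hinj)
  refine ⟨a, fun j hj => ?_⟩
  rcases Nat.eq_zero_or_pos j with rfl | hj0
  · simp
  have hsin : 0 < Real.sin (j * (Real.pi / (n + 1))) :=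
    Real.sin_pos_of_pos_of_lt_pi (by positivity) (hlt j hj)
  have h1 := Lagrange.eval_interpolate_at_node (s := s) r hinj
    (i := j) (by simp [s]; omega)
  rw [ha, Polynomial.eval_finsetSum] at h1
  have h2 : (∑ k ∈ Finset.range n, (a k • Polynomial.Chebyshev.U ℝ (k : ℤ)).eval
      (Real.cos (j * (Real.pi / (n + 1))))) * Real.sin (j * (Real.pi / (n + 1))) =
      j * (Real.pi / (n + 1)) := by
    rw [h1]; exact div_mul_cancel₀ _ hsin.ne'
  refine Eq.trans ?_ h2
  rw [Finset.sum_mul]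
  refine Finset.sum_congr rfl fun k _ => ?_
  rw [Polynomial.eval_smul, smul_eq_mul, mul_assoc, Polynomial.Chebyshev.U_real_cos]
  push_cast
  rfl

/-- Rolle's theorem for several zeros: between `N` zeros of a function there are `N - 1` zeros of
its derivative which are different from them. -/
theorem exists_finset_deriv_eq_zero {F F' : ℝ → ℝ} (hF : ∀ x, HasDerivAt F (F' x) x)
    (Z : Finset ℝ) (hZ : ∀ x ∈ Z, F x = 0) (hne : Z.Nonempty) :
    ∃ Z' : Finset ℝ, Z'.card + 1 = Z.card ∧
      ∀ z ∈ Z', F' z = 0 ∧ z ∉ Z ∧ (∃ x ∈ Z, x < z) ∧ ∃ y ∈ Z, z < y := by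
  induction Z using Finset.induction_on_max with
  | empty => exact absurd hne (by simp)
  | insert a s hs ih =>
    rcases s.eq_empty_or_nonempty with rfl | hsne
    · exact ⟨∅, by simp⟩
    obtain ⟨Z', hcard, hZ'⟩ := ih (fun x hx => hZ x (by simp [hx])) hsne
    have hb := s.max'_mem hsne
    have hba := hs _ hb
    obtain ⟨c, hc, hc'⟩ := exists_hasDerivAt_eq_zero (f := F) (f' := F') hba
      (fun x _ => (hF x).continuousAt.continuousWithinAt)
      (by rw [hZ _ (by simp [hb]), hZ a (by simp)]) (fun x _ => hF x)
    have hmax : ∀ x ∈ s, x ≤ s.max' hsne := fun x hx => s.le_max' x hx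
    have hcZ' : c ∉ Z' := by
      intro h
      obtain ⟨-, -, -, y, hy, hcy⟩ := hZ' c h
      exact absurd (hcy.trans_le (hmax y hy)) (not_lt.2 hc.1.le)
    have ha : a ∉ s := fun h => lt_irrefl _ (hs a h)
    refine ⟨insert c Z', by rw [Finset.card_insert_of_notMem hcZ',
      Finset.card_insert_of_notMem ha, hcard], fun z hz => ?_⟩
    rcases Finset.mem_insert.1 hz with rfl | hz
    · refine ⟨hc', ?_, ⟨_, Finset.mem_insert_of_mem hb, hc.1⟩, a, by simp, hc.2⟩
      intro h
      rcases Finset.mem_insert.1 h with rfl | h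
      · exact lt_irrefl _ hc.2
      · exact absurd (hmax z h) (not_le.2 hc.1)
    · obtain ⟨h1, h2, ⟨x, hx, hxz⟩, y, hy, hzy⟩ := hZ' z hz
      refine ⟨h1, ?_, ⟨x, by simp [hx], hxz⟩, y, by simp [hy], hzy⟩
      intro h
      rcases Finset.mem_insert.1 h with rfl | h
      · exact absurd (hzy.trans (hs y hy)) (lt_irrefl _)
      · exact h2 h

theorem hasDerivAt_sub_sine_sum (n : ℕ) (a : ℕ → ℝ) (x : ℝ) :
    HasDerivAt (fun x => x - ∑ k ∈ Finset.range n, a k * Real.sin ((k + 1) * x))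
      (1 - ∑ k ∈ Finset.range n, a k * ((k + 1) * Real.cos ((k + 1) * x))) x := by
  refine (hasDerivAt_id x).sub (HasDerivAt.fun_sum fun k _ => ?_)
  have := (((hasDerivAt_id x).const_mul ((k : ℝ) + 1)).sin).const_mul (a k)
  simpa [mul_comm, mul_left_comm] using this

/-- The derivative of `x - ∑ a_k sin (k x)`, a polynomial of degree at most `n` in `cos x`, has at
most `n` zeros in `(0, π)`. -/
theorem card_zeros_deriv_sub_sine_sum_le (n : ℕ) (a : ℕ → ℝ) (Z : Finset ℝ)
    (hZ : ∀ z ∈ Z, z ∈ Set.Ioo 0 Real.pi ∧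
      1 - ∑ k ∈ Finset.range n, a k * ((k + 1) * Real.cos ((k + 1) * z)) = 0) :
    Z.card ≤ n := by
  let R : Polynomial ℝ := 1 - ∑ k ∈ Finset.range n,
    Polynomial.C (a k * (k + 1)) * Polynomial.Chebyshev.T ℝ ((k : ℤ) + 1)
  have hR : ∀ x, R.eval (Real.cos x) =
      1 - ∑ k ∈ Finset.range n, a k * ((k + 1) * Real.cos ((k + 1) * x)) := by
    intro x
    simp only [R, Polynomial.eval_sub, Polynomial.eval_one, Polynomial.eval_finsetSum,
      Polynomial.eval_mul, Polynomial.eval_C, Polynomial.Chebyshev.T_real_cos]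
    push_cast
    simp only [mul_assoc]
  have hdeg : R.natDegree ≤ n := by
    refine (Polynomial.natDegree_sub_le _ _).trans (max_le (by simp) ?_)
    refine Polynomial.natDegree_sum_le_of_forall_le _ _ fun k hk => ?_
    refine (Polynomial.natDegree_C_mul_le _ _).trans ?_
    rw [Polynomial.Chebyshev.natDegree_T]
    have := Finset.mem_range.1 hk
    omega
  have hR0 : R ≠ 0 := by
    intro h0
    -- otherwise `x - ∑ a_k sin (k x)` is constant, but its values at `0` and `π` differ
    have hd : ∀ x, HasDerivAt (fun x => x - ∑ k ∈ Finset.range n,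
        a k * Real.sin ((k + 1) * x)) 0 x := by
      intro x
      have := hasDerivAt_sub_sine_sum n a x
      rwa [← hR x, h0, Polynomial.eval_zero] at this
    have hc := is_const_of_deriv_eq_zero (fun x => (hd x).differentiableAt)
      (fun x => (hd x).deriv) Real.pi 0
    have hs : ∑ k ∈ Finset.range n, a k * Real.sin ((k + 1) * Real.pi) = 0 := by
      refine Finset.sum_eq_zero fun k _ => ?_
      have := Real.sin_nat_mul_pi (k + 1)
      push_cast at this
      rw [this, mul_zero]
    simp only [hs, mul_zero, Real.sin_zero, Finset.sum_const_zero, sub_zero] at hc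
    exact Real.pi_ne_zero hc
  calc Z.card = (Z.image Real.cos).card := by
        rw [Finset.card_image_of_injOn]
        intro x hx y hy hxy
        exact Real.injOn_cos ⟨(hZ x hx).1.1.le, (hZ x hx).1.2.le⟩
          ⟨(hZ y hy).1.1.le, (hZ y hy).1.2.le⟩ hxy
    _ ≤ R.roots.toFinset.card := by
        refine Finset.card_le_card fun y hy => ?_
        obtain ⟨x, hx, rfl⟩ := Finset.mem_image.1 hy
        rw [Multiset.mem_toFinset, Polynomial.mem_roots hR0, Polynomial.IsRoot, hR x]
        exact (hZ x hx).2
    _ ≤ Multiset.card R.roots := Multiset.toFinset_card_le _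
    _ ≤ n := (Polynomial.card_roots' R).trans hdeg

/-- A sine polynomial of degree at most `n` which interpolates `x` at the points `j π / (n + 1)`
crosses `x` there and nowhere else in `(0, π)`: the sign of the difference alternates. -/
theorem exists_sign_sub_sine_sum {n : ℕ} {a : ℕ → ℝ}
    (ha : ∀ j ≤ n, ∑ k ∈ Finset.range n, a k * Real.sin ((k + 1) * (j * (Real.pi / (n + 1)))) =
        j * (Real.pi / (n + 1))) :
    ∃ ε : ℝ, |ε| = 1 ∧ ∀ j ≤ n, ∀ x ∈ Set.Ioo (j * (Real.pi / (n + 1)))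
      ((j + 1 : ℕ) * (Real.pi / (n + 1))),
      |x - ∑ k ∈ Finset.range n, a k * Real.sin ((k + 1) * x)| =
        ε * ((-1) ^ j * (x - ∑ k ∈ Finset.range n, a k * Real.sin ((k + 1) * x))) := by
  set F : ℝ → ℝ := fun x => x - ∑ k ∈ Finset.range n, a k * Real.sin ((k + 1) * x) with hFdef
  set F' : ℝ → ℝ := fun x => 1 - ∑ k ∈ Finset.range n,
    a k * ((k + 1) * Real.cos ((k + 1) * x)) with hF'def
  have hF : ∀ x, HasDerivAt F (F' x) x := hasDerivAt_sub_sine_sum n a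
  have hcont : Continuous F := continuous_iff_continuousAt.2 fun x => (hF x).continuousAt
  set α : ℝ := Real.pi / (n + 1) with hαdef
  have hα : 0 < α := by positivity
  have hnα : (n + 1 : ℝ) * α = Real.pi := by rw [hαdef]; field_simp
  have hle : ∀ j : ℕ, j ≤ n → (j : ℝ) * α < Real.pi := by
    intro j hj
    rw [← hnα]
    have h1 : (j : ℝ) < n + 1 := by exact_mod_cast Nat.lt_succ_of_le hj
    gcongr
  have hFj : ∀ j : ℕ, j ≤ n → F (j * α) = 0 := fun j hj => sub_eq_zero.2 (ha j hj).symm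
  set Z₀ : Finset ℝ := (Finset.range (n + 1)).image fun j : ℕ => (j : ℝ) * α with hZ₀
  have hZ₀card : Z₀.card = n + 1 := by
    rw [hZ₀, Finset.card_image_of_injective, Finset.card_range]
    intro i j hij
    exact_mod_cast mul_right_cancel₀ hα.ne' hij
  have hZ₀F : ∀ x ∈ Z₀, F x = 0 ∧ 0 ≤ x ∧ x < Real.pi := by
    intro x hx
    obtain ⟨j, hj, rfl⟩ := Finset.mem_image.1 hx
    have hj : j ≤ n := Nat.lt_succ_iff.1 (Finset.mem_range.1 hj)
    exact ⟨hFj j hj, by positivity, hle j hj⟩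
  -- a further zero of `F`, or a multiple one, would give `n + 1` zeros of `F'`
  have hsimple : ∀ z ∈ Z₀, 0 < z → F' z ≠ 0 := by
    intro z hz hz0 hz'
    obtain ⟨Z', hcard, hZ'⟩ := exists_finset_deriv_eq_zero hF Z₀ (fun x hx => (hZ₀F x hx).1)
      ⟨z, hz⟩
    have hzZ' : z ∉ Z' := fun h => (hZ' z h).2.1 hz
    have := card_zeros_deriv_sub_sine_sum_le n a (insert z Z') (by
      intro y hy
      rcases Finset.mem_insert.1 hy with rfl | hy
      · exact ⟨⟨hz0, (hZ₀F y hz).2.2⟩, hz'⟩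
      · obtain ⟨h1, -, ⟨u, hu, huy⟩, v, hv, hyv⟩ := hZ' y hy
        exact ⟨⟨(hZ₀F u hu).2.1.trans_lt huy, hyv.trans (hZ₀F v hv).2.2⟩, h1⟩)
    rw [Finset.card_insert_of_notMem hzZ'] at this
    omega
  have honly : ∀ z, 0 < z → z < Real.pi → z ∉ Z₀ → F z ≠ 0 := by
    intro z hz0 hzπ hz hz'
    have hbd : ∀ x ∈ insert z Z₀, F x = 0 ∧ 0 ≤ x ∧ x < Real.pi := by
      intro x hx
      rcases Finset.mem_insert.1 hx with rfl | hx
      · exact ⟨hz', hz0.le, hzπ⟩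
      · exact hZ₀F x hx
    obtain ⟨Z', hcard, hZ'⟩ := exists_finset_deriv_eq_zero hF (insert z Z₀)
      (fun x hx => (hbd x hx).1) ⟨z, by simp⟩
    have := card_zeros_deriv_sub_sine_sum_le n a Z' (by
      intro y hy
      obtain ⟨h1, -, ⟨u, hu, huy⟩, v, hv, hyv⟩ := hZ' y hy
      exact ⟨⟨(hbd u hu).2.1.trans_lt huy, hyv.trans (hbd v hv).2.2⟩, h1⟩)
    rw [Finset.card_insert_of_notMem hz] at hcard
    omega
  have hne : ∀ j ≤ n, ∀ x ∈ Set.Ioo (j * α) ((j + 1 : ℕ) * α), F x ≠ 0 := by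
    intro j hj x hx
    have hxπ : x < Real.pi := by
      refine hx.2.trans_le ?_
      rw [← hnα]
      have h1 : ((j + 1 : ℕ) : ℝ) ≤ n + 1 := by exact_mod_cast Nat.succ_le_succ hj
      gcongr
    refine honly x (lt_of_le_of_lt (by positivity) hx.1) hxπ fun h => ?_
    obtain ⟨i, -, rfl⟩ := Finset.mem_image.1 h
    have h1 : j < i := by exact_mod_cast lt_of_mul_lt_mul_right hx.1 hα.le
    have h2 : i < j + 1 := by exact_mod_cast lt_of_mul_lt_mul_right hx.2 hα.le
    omega
  have hsame : ∀ j ≤ n, ∀ x ∈ Set.Ioo (j * α) ((j + 1 : ℕ) * α),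
      ∀ y ∈ Set.Ioo (j * α) ((j + 1 : ℕ) * α), 0 < F x * F y := by
    intro j hj x hx y hy
    by_contra hneg
    have h0 : (0 : ℝ) ∈ Set.uIcc (F x) (F y) := by
      rw [Set.mem_uIcc]
      rcases mul_nonpos_iff.1 (not_lt.1 hneg) with h | h
      · exact Or.inr ⟨h.2, h.1⟩
      · exact Or.inl h
    obtain ⟨z, hz, hz0⟩ := intermediate_value_uIcc hcont.continuousOn h0
    exact hne j hj z (Set.OrdConnected.uIcc_subset Set.ordConnected_Ioo hx hy hz) hz0
  have h01 : (α / 2) ∈ Set.Ioo ((0 : ℕ) * α) ((0 + 1 : ℕ) * α) := by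
    constructor <;> simp <;> linarith
  have halt : ∀ j ≤ n, ∀ x ∈ Set.Ioo (j * α) ((j + 1 : ℕ) * α),
      0 < (-1) ^ j * F x * F (α / 2) := by
    intro j
    induction j with
    | zero => intro hj x hx; simpa using hsame 0 hj x hx _ h01
    | succ j ih =>
      intro hj x hx
      by_contra hneg
      set s : ℝ := (-1) ^ j * F (α / 2) with hs
      have hs0 : s ≠ 0 := mul_ne_zero (by simp) (hne 0 (Nat.zero_le _) _ h01)
      have hxne := hne _ hj x hx
      have hsx : 0 < s * F x := by
        rcases lt_or_gt_of_ne (mul_ne_zero hs0 hxne) with h | h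
        · refine absurd ?_ hneg
          have : (-1) ^ (j + 1) * F x * F (α / 2) = -(s * F x) := by rw [hs]; ring
          linarith
        · exact h
      -- then `s F` is positive on both sides of the node, where it has a local minimum
      have hmin : IsLocalMin (fun y => s * F y) ((j + 1 : ℕ) * α) := by
        have hnhds : Set.Ioo (j * α) ((j + 1 + 1 : ℕ) * α) ∈ nhds (((j + 1 : ℕ) : ℝ) * α) := by
          refine Ioo_mem_nhds ?_ ?_ <;> · push_cast; nlinarith
        filter_upwards [hnhds] with y hy
        rw [hFj _ hj, mul_zero]
        rcases lt_trichotomy y ((j + 1 : ℕ) * α) with h | h | h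
        · have := ih (by omega) y ⟨hy.1, h⟩
          rw [hs]; nlinarith
        · rw [h, hFj _ hj, mul_zero]
        · have h1 := hsame _ hj x hx y ⟨h, hy.2⟩
          have h2 : 0 < (s * F x) * (s * F y) := by
            have : (s * F x) * (s * F y) = s ^ 2 * (F x * F y) := by ring
            rw [this]; positivity
          exact (pos_of_mul_pos_right h2 hsx.le).le
      have hd := hmin.hasDerivAt_eq_zero ((hF _).const_mul s)
      rcases mul_eq_zero.1 hd with h | h
      · exact hs0 h
      · exact hsimple _ (Finset.mem_image.2 ⟨j + 1, by simp; omega, rfl⟩) (by positivity) h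
  have hc := hne 0 (Nat.zero_le _) _ h01
  refine ⟨F (α / 2) / |F (α / 2)|, by rw [abs_div, abs_abs, div_self (abs_ne_zero.2 hc)], ?_⟩
  intro j hj x hx
  have h1 := halt j hj x hx
  have h2 : |(-1) ^ j * F x * F (α / 2)| = (-1) ^ j * F x * F (α / 2) := abs_of_pos h1
  rw [abs_mul, abs_mul, abs_pow, abs_neg, abs_one, one_pow, one_mul] at h2
  rw [div_mul_eq_mul_div, eq_div_iff (abs_ne_zero.2 hc)]
  change |F x| * _ = F (α / 2) * ((-1) ^ j * F x)
  rw [h2]; ring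

theorem sum_neg_one_pow_mul_odd (m : ℕ) :
    ∑ j ∈ Finset.range m, (-1 : ℝ) ^ j * (2 * j + 1) = -((-1) ^ m * m) := by
  induction m with
  | zero => simp
  | succ m ih => rw [Finset.sum_range_succ, ih, pow_succ]; push_cast; ring

/-- `cos (k x)` with `k < m` is orthogonal to the sign of `sin (m x)`, in integrated form. -/
theorem sum_neg_one_pow_mul_cos_sub_cos {k m : ℕ} (hkm : k < m) :
    ∑ j ∈ Finset.range m, (-1 : ℝ) ^ j * (Real.cos (k * ((j + 1 : ℕ) * (Real.pi / m))) -
      Real.cos (k * (j * (Real.pi / m)))) = 0 := by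
  have hm : (0 : ℝ) < m := by exact_mod_cast (Nat.zero_le k).trans_lt hkm
  set β : ℝ := k * (Real.pi / m) / 2 with hβ
  have hcos : Real.cos β ≠ 0 := by
    refine (Real.cos_pos_of_mem_Ioo ⟨?_, ?_⟩).ne'
    · have : 0 ≤ β := by positivity
      linarith [Real.pi_pos]
    · have : (k : ℝ) * (Real.pi / m) < m * (Real.pi / m) := by
        have : (k : ℝ) < m := by exact_mod_cast hkm
        gcongr
      rw [mul_div_cancel₀ _ hm.ne'] at this
      linarith
  -- after multiplication by `cos β` the sum telescopes
  have key : ∀ N : ℕ, (∑ j ∈ Finset.range N, (-1 : ℝ) ^ j *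
      (Real.cos (k * ((j + 1 : ℕ) * (Real.pi / m))) - Real.cos (k * (j * (Real.pi / m))))) *
        Real.cos β = (-1) ^ N * Real.sin (k * (N * (Real.pi / m))) * Real.sin β := by
    intro N
    induction N with
    | zero => simp
    | succ N ih =>
      rw [Finset.sum_range_succ, add_mul, ih]
      have e1 : (k : ℝ) * ((N + 1 : ℕ) * (Real.pi / m)) = k * (N * (Real.pi / m)) + 2 * β := by
        rw [hβ]; push_cast; ring
      rw [e1, Real.cos_add, Real.sin_add, Real.cos_two_mul, Real.sin_two_mul, pow_succ]
      have := Real.sin_sq_add_cos_sq β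
      linear_combination (-1 : ℝ) ^ N * (2 * Real.cos (k * (N * (Real.pi / m))) * Real.cos β) * this
  have := key m
  rw [mul_div_cancel₀ _ hm.ne', Real.sin_nat_mul_pi, mul_zero, zero_mul] at this
  exact (mul_eq_zero.1 this).resolve_right hcos

/-- The interpolating sine polynomial is a best `L¹` approximation of `x` on `(0, π)`; its error
is at most `π² / (2 (n + 1))`. -/
theorem integral_abs_sub_sine_sum_le {n : ℕ} {a : ℕ → ℝ}
    (ha : ∀ j ≤ n, ∑ k ∈ Finset.range n, a k * Real.sin ((k + 1) * (j * (Real.pi / (n + 1)))) =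
        j * (Real.pi / (n + 1))) :
    ∫ x in (0 : ℝ)..Real.pi, |x - ∑ k ∈ Finset.range n, a k * Real.sin ((k + 1) * x)| ≤
      Real.pi ^ 2 / (2 * (n + 1)) := by
  obtain ⟨ε, hε, hsgn⟩ := exists_sign_sub_sine_sum ha
  set F : ℝ → ℝ := fun x => x - ∑ k ∈ Finset.range n, a k * Real.sin ((k + 1) * x) with hFdef
  have hcont : Continuous F := by simp only [hFdef]; fun_prop
  set α : ℝ := Real.pi / (n + 1) with hαdef
  have hα : 0 < α := by positivity
  have hnα : ((n + 1 : ℕ) : ℝ) * α = Real.pi := by rw [hαdef]; push_cast; field_simp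
  let H : ℝ → ℝ := fun x => x ^ 2 / 2 +
    ∑ k ∈ Finset.range n, a k / (k + 1) * Real.cos ((k + 1) * x)
  have hH : ∀ x, HasDerivAt H (F x) x := by
    intro x
    have h1 : HasDerivAt (fun x : ℝ => x ^ 2 / 2) x x := by
      simpa using (hasDerivAt_pow 2 x).div_const 2
    have h2 : HasDerivAt (fun x : ℝ => ∑ k ∈ Finset.range n, a k / (k + 1) *
        Real.cos ((k + 1) * x)) (∑ k ∈ Finset.range n, -(a k * Real.sin ((k + 1) * x))) x := by
      refine HasDerivAt.fun_sum fun k _ => ?_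
      have h3 := (((hasDerivAt_id x).const_mul ((k : ℝ) + 1)).cos).const_mul (a k / (k + 1))
      refine h3.congr_deriv ?_
      have : (k : ℝ) + 1 ≠ 0 := by positivity
      simp only [id]
      field_simp
    refine (h1.add h2).congr_deriv ?_
    simp only [hFdef, Finset.sum_neg_distrib, sub_eq_add_neg]
  have hpiece : ∀ j ∈ Finset.range (n + 1),
      ∫ x in (j * α)..((j + 1 : ℕ) * α), |F x| =
        ε * ((-1) ^ j * (H ((j + 1 : ℕ) * α) - H (j * α))) := by
    intro j hj
    have hj : j ≤ n := Nat.lt_succ_iff.1 (Finset.mem_range.1 hj)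
    rw [intervalIntegral.integral_congr_Ioo_of_le (by push_cast; nlinarith)
      (fun x hx => hsgn j hj x hx), intervalIntegral.integral_const_mul,
      intervalIntegral.integral_const_mul,
      intervalIntegral.integral_eq_sub_of_hasDerivAt (fun x _ => hH x)
        (hcont.intervalIntegrable _ _)]
  have hsplit := intervalIntegral.sum_integral_adjacent_intervals (μ := volume)
    (f := fun x => |F x|) (a := fun j : ℕ => (j : ℝ) * α) (n := n + 1)
    (fun k _ => hcont.abs.intervalIntegrable _ _)
  rw [Finset.sum_congr rfl hpiece] at hsplit
  simp only [Nat.cast_zero, zero_mul] at hsplit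
  rw [hnα] at hsplit
  rw [← hsplit, ← Finset.mul_sum]
  have hval : ∑ j ∈ Finset.range (n + 1), (-1 : ℝ) ^ j * (H ((j + 1 : ℕ) * α) - H (j * α)) =
      α ^ 2 / 2 * -((-1) ^ (n + 1) * (n + 1 : ℕ)) := by
    rw [← sum_neg_one_pow_mul_odd, Finset.mul_sum]
    have e : ∀ j : ℕ, (-1 : ℝ) ^ j * (H ((j + 1 : ℕ) * α) - H (j * α)) =
        α ^ 2 / 2 * ((-1 : ℝ) ^ j * (2 * j + 1)) + ∑ k ∈ Finset.range n, a k / (k + 1) *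
          ((-1 : ℝ) ^ j * (Real.cos ((k + 1) * ((j + 1 : ℕ) * α)) -
            Real.cos ((k + 1) * (j * α)))) := by
      intro j
      simp only [H]
      rw [add_sub_add_comm, ← Finset.sum_sub_distrib, mul_add, Finset.mul_sum]
      congr 1
      · push_cast; ring
      · exact Finset.sum_congr rfl fun k _ => by ring
    simp only [e]
    rw [Finset.sum_add_distrib, Finset.sum_comm]
    refine add_eq_left.2 (Finset.sum_eq_zero fun k hk => ?_)
    rw [← Finset.mul_sum]
    have := sum_neg_one_pow_mul_cos_sub_cos (k := k + 1) (m := n + 1)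
      (by have := Finset.mem_range.1 hk; omega)
    push_cast at this ⊢
    rw [this, mul_zero]
  rw [hval]
  refine (le_abs_self _).trans (le_of_eq ?_)
  rw [abs_mul, hε, abs_mul, abs_neg, abs_mul, abs_pow, abs_neg, abs_one, one_pow, Nat.abs_cast,
    abs_of_nonneg (by positivity), hαdef]
  push_cast
  field_simp

/-- The Fourier coefficient of a translate of an even periodic function: by evenness only the cosine
term remains. -/
theorem integral_cos_mul_periodic_even {G : ℝ → ℝ} (hG : Continuous G)
    (hper : Function.Periodic G (2 * Real.pi)) (heven : ∀ x, G (-x) = G x) (k : ℕ) (θ : ℝ) :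
    ∫ x in (-Real.pi)..Real.pi, Real.cos (k * x) * G (x + (θ + Real.pi)) =
      Real.cos (k * θ) * ∫ y in (-Real.pi)..Real.pi, Real.cos (k * (y - Real.pi)) * G y := by
  have hshift : ∫ x in (-Real.pi)..Real.pi, Real.cos (k * x) * G (x + (θ + Real.pi)) =
      ∫ y in (-Real.pi)..Real.pi, Real.cos (k * (y - (θ + Real.pi))) * G y := by
    have hp : Function.Periodic (fun y => Real.cos (k * (y - (θ + Real.pi))) * G y)
        (2 * Real.pi) := by
      intro y
      simp only [hper y]
      congr 1
      rw [← Real.cos_add_nat_mul_two_pi (k * (y - (θ + Real.pi))) k]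
      congr 1; ring
    have h1 := intervalIntegral.integral_comp_add_right (a := -Real.pi) (b := Real.pi)
      (fun y => Real.cos (k * (y - (θ + Real.pi))) * G y) (θ + Real.pi)
    simp only [add_sub_cancel_right] at h1
    rw [h1]
    have h2 := hp.intervalIntegral_add_eq (-Real.pi + (θ + Real.pi)) (-Real.pi)
    convert h2 using 2 <;> ring
  have hodd : ∫ y in (-Real.pi)..Real.pi, Real.sin (k * (y - Real.pi)) * G y = 0 := by
    have h1 := intervalIntegral.integral_comp_neg (a := -Real.pi) (b := Real.pi)
      (fun y => Real.sin (k * (y - Real.pi)) * G y)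
    rw [neg_neg] at h1
    have h2 : ∀ y, Real.sin (k * (-y - Real.pi)) * G (-y) =
        -(Real.sin (k * (y - Real.pi)) * G y) := by
      intro y
      have e : Real.sin (k * (-y - Real.pi)) = -Real.sin (k * (y - Real.pi)) := by
        rw [← Real.sin_neg, ← Real.sin_add_nat_mul_two_pi (k * (-y - Real.pi)) k]
        congr 1; ring
      rw [heven, e, neg_mul]
    simp only [h2, intervalIntegral.integral_neg] at h1
    linarith
  rw [hshift]
  have e : ∀ y, Real.cos (k * (y - (θ + Real.pi))) * G y =
      Real.cos (k * θ) * (Real.cos (k * (y - Real.pi)) * G y) +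
        Real.sin (k * θ) * (Real.sin (k * (y - Real.pi)) * G y) := by
    intro y
    rw [show (k : ℝ) * (y - (θ + Real.pi)) = k * (y - Real.pi) - k * θ by ring, Real.cos_sub]
    ring
  simp only [e]
  rw [intervalIntegral.integral_add
      (Continuous.intervalIntegrable (by fun_prop) _ _)
      (Continuous.intervalIntegrable (by fun_prop) _ _),
    intervalIntegral.integral_const_mul, intervalIntegral.integral_const_mul, hodd, mul_zero,
    add_zero]

/-- Favard's inequality for even periodic functions: the convolution of `G'` with the sine
polynomial closest to the sawtooth `x` is a polynomial in `cos θ`. -/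
theorem exists_polynomial_near_even_periodic {G G' : ℝ → ℝ} (hG : ∀ x, HasDerivAt G (G' x) x)
    (hG' : Continuous G') (hper : Function.Periodic G (2 * Real.pi))
    (heven : ∀ x, G (-x) = G x) {M : ℝ} (hM : ∀ x, |G' x| ≤ M) (n : ℕ) :
    ∃ P : Polynomial ℝ, P.natDegree ≤ n ∧
      ∀ θ, |G θ - P.eval (Real.cos θ)| ≤ Real.pi / 2 / (n + 1) * M := by
  obtain ⟨a, ha⟩ := exists_sine_interpolation n
  have hGc : Continuous G := continuous_iff_continuousAt.2 fun x => (hG x).continuousAt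
  set F : ℝ → ℝ := fun x => x - ∑ k ∈ Finset.range n, a k * Real.sin ((k + 1) * x) with hFdef
  have hFc : Continuous F := by simp only [hFdef]; fun_prop
  let c : ℕ → ℝ := fun k =>
    ∫ y in (-Real.pi)..Real.pi, Real.cos (k * (y - Real.pi)) * G y
  let P : Polynomial ℝ := Polynomial.C (1 / (2 * Real.pi)) * (Polynomial.C (c 0) -
    ∑ k ∈ Finset.range n, Polynomial.C (a k * (k + 1) * c (k + 1)) *
      Polynomial.Chebyshev.T ℝ ((k : ℤ) + 1))
  have hP : ∀ θ, 2 * Real.pi * P.eval (Real.cos θ) =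
      c 0 - ∑ k ∈ Finset.range n, a k * (k + 1) * c (k + 1) * Real.cos ((k + 1) * θ) := by
    intro θ
    simp only [P, Polynomial.eval_sub, Polynomial.eval_finsetSum,
      Polynomial.eval_mul, Polynomial.eval_C, Polynomial.Chebyshev.T_real_cos]
    push_cast
    rw [← mul_assoc, mul_one_div_cancel (by positivity), one_mul]
  have hdeg : P.natDegree ≤ n := by
    refine (Polynomial.natDegree_C_mul_le _ _).trans ?_
    refine (Polynomial.natDegree_sub_le _ _).trans (max_le (by simp) ?_)
    refine Polynomial.natDegree_sum_le_of_forall_le _ _ fun k hk => ?_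
    refine (Polynomial.natDegree_C_mul_le _ _).trans ?_
    rw [Polynomial.Chebyshev.natDegree_T]
    have := Finset.mem_range.1 hk
    omega
  refine ⟨P, hdeg, fun θ => ?_⟩
  have hFπ : F Real.pi = Real.pi := by
    simp only [hFdef]
    refine sub_eq_self.2 (Finset.sum_eq_zero fun k _ => ?_)
    have := Real.sin_nat_mul_pi (k + 1)
    push_cast at this
    rw [this, mul_zero]
  have hFodd : ∀ x, F (-x) = -F x := by
    intro x
    simp only [hFdef, mul_neg, Real.sin_neg, Finset.sum_neg_distrib]
    ring
  -- integrate by parts against the kernel `F`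
  have hparts := intervalIntegral.integral_mul_deriv_eq_deriv_mul (a := -Real.pi) (b := Real.pi)
    (u := F) (v := fun x => G (x + (θ + Real.pi))) (v' := fun x => G' (x + (θ + Real.pi)))
    (fun x _ => hasDerivAt_sub_sine_sum n a x)
    (fun x _ => (hG _).comp_add_const x _)
    (Continuous.intervalIntegrable (by fun_prop) _ _)
    (Continuous.intervalIntegrable (by fun_prop) _ _)
  have hint : ∫ x in (-Real.pi)..Real.pi, (1 - ∑ k ∈ Finset.range n,
      a k * ((k + 1) * Real.cos ((k + 1) * x))) * G (x + (θ + Real.pi)) =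
      2 * Real.pi * P.eval (Real.cos θ) := by
    have h0 := integral_cos_mul_periodic_even hGc hper heven 0 θ
    have h1 := fun k : ℕ => integral_cos_mul_periodic_even hGc hper heven (k + 1) θ
    simp only [Nat.cast_zero, zero_mul, Real.cos_zero, one_mul] at h0
    rw [hP]
    have e : ∀ x, (1 - ∑ k ∈ Finset.range n,
        a k * ((k + 1) * Real.cos ((k + 1) * x))) * G (x + (θ + Real.pi)) =
        G (x + (θ + Real.pi)) - ∑ k ∈ Finset.range n, a k * (k + 1) *
          (Real.cos ((k + 1 : ℕ) * x) * G (x + (θ + Real.pi))) := by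
      intro x
      rw [sub_mul, one_mul, Finset.sum_mul]
      congr 1
      refine Finset.sum_congr rfl fun k _ => ?_
      push_cast; ring
    simp only [e]
    rw [intervalIntegral.integral_sub (Continuous.intervalIntegrable (by fun_prop) _ _)
      (Continuous.intervalIntegrable (by fun_prop) _ _),
      intervalIntegral.integral_finsetSum
        (fun k _ => Continuous.intervalIntegrable (by fun_prop) _ _), h0]
    congr 1
    · simp [c]
    · refine Finset.sum_congr rfl fun k _ => ?_
      rw [intervalIntegral.integral_const_mul, h1]
      simp only [c]
      push_cast
      ring
  have hGπ : G (-Real.pi + (θ + Real.pi)) = G θ := by congr 1; ring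
  have hGπ' : G (Real.pi + (θ + Real.pi)) = G θ := by
    rw [← hper θ]; congr 1; ring
  rw [hint, hFodd, hFπ, hGπ, hGπ'] at hparts
  have hL1 : ∫ x in (-Real.pi)..Real.pi, |F x| ≤ Real.pi ^ 2 / (n + 1) := by
    have h1 := integral_abs_sub_sine_sum_le ha
    have h2 := intervalIntegral.integral_comp_neg (a := 0) (b := Real.pi) (fun x => |F x|)
    simp only [hFodd, abs_neg, neg_zero] at h2
    rw [← intervalIntegral.integral_add_adjacent_intervals (b := 0)
      (hFc.abs.intervalIntegrable _ _) (hFc.abs.intervalIntegrable _ _), ← h2]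
    change ∫ x in (0 : ℝ)..Real.pi, |F x| ≤ _ at h1
    calc _ ≤ Real.pi ^ 2 / (2 * (n + 1)) + Real.pi ^ 2 / (2 * (n + 1)) := add_le_add h1 h1
      _ = _ := by field_simp; norm_num
  have hM0 : 0 ≤ M := (abs_nonneg _).trans (hM 0)
  have hbound : |∫ x in (-Real.pi)..Real.pi, F x * G' (x + (θ + Real.pi))| ≤
      Real.pi ^ 2 / (n + 1) * M := by
    have hle : -Real.pi ≤ Real.pi := by linarith [Real.pi_pos]
    refine (intervalIntegral.abs_integral_le_integral_abs hle).trans ?_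
    calc _ ≤ ∫ x in (-Real.pi)..Real.pi, |F x| * M := by
          refine intervalIntegral.integral_mono_on hle
            (Continuous.intervalIntegrable (by fun_prop) _ _)
            (Continuous.intervalIntegrable (by fun_prop) _ _) fun x _ => ?_
          rw [abs_mul]
          exact mul_le_mul_of_nonneg_left (hM _) (abs_nonneg _)
      _ = (∫ x in (-Real.pi)..Real.pi, |F x|) * M := intervalIntegral.integral_mul_const _ _
      _ ≤ _ := mul_le_mul_of_nonneg_right hL1 hM0
  rw [hparts] at hbound
  have e : Real.pi * G θ - -Real.pi * G θ - 2 * Real.pi * P.eval (Real.cos θ) =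
      2 * Real.pi * (G θ - P.eval (Real.cos θ)) := by ring
  rw [e, abs_mul, abs_of_pos (by positivity)] at hbound
  have h2π : (0 : ℝ) < 2 * Real.pi := by positivity
  rw [← mul_le_mul_iff_right₀ h2π]
  refine hbound.trans (le_of_eq ?_)
  field_simp

/-- Favard's inequality on `[-D, D]`, for functions with derivative bounded by `M`. -/
theorem exists_polynomial_near_of_deriv_le {f : ℝ → ℝ} (hf : ContDiff ℝ 1 f) {D M : ℝ}
    (hD : 0 ≤ D) (hM : ∀ x ∈ Set.Icc (-D) D, |deriv f x| ≤ M) (n : ℕ) :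
    ∃ P : Polynomial ℝ, P.natDegree ≤ n ∧
      ∀ x ∈ Set.Icc (-D) D, |f x - P.eval x| ≤ Real.pi / 2 * D / (n + 1) * M := by
  rcases hD.eq_or_lt with rfl | hD
  · refine ⟨Polynomial.C (f 0), by simp, fun x hx => ?_⟩
    have : x = 0 := le_antisymm (by simpa using hx.2) (by simpa using hx.1)
    simp [this]
  have hmem : ∀ θ, D * Real.cos θ ∈ Set.Icc (-D) D := fun θ =>
    ⟨by nlinarith [Real.neg_one_le_cos θ], by nlinarith [Real.cos_le_one θ]⟩
  have hder : ∀ x, HasDerivAt f (deriv f x) x := fun x =>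
    (hf.differentiable (by norm_num) x).hasDerivAt
  have hdc : Continuous (deriv f) := hf.continuous_deriv le_rfl
  obtain ⟨P, hP, hPG⟩ := exists_polynomial_near_even_periodic
    (G := fun θ => f (D * Real.cos θ))
    (G' := fun θ => deriv f (D * Real.cos θ) * (D * -Real.sin θ))
    (fun θ => (hder _).comp θ ((Real.hasDerivAt_cos θ).const_mul D))
    (by fun_prop) (fun θ => by simp) (fun θ => by simp) (M := M * D)
    (fun θ => by
      rw [abs_mul, abs_mul, abs_neg, abs_of_pos hD]
      have h1 := hM _ (hmem θ)
      have h2 := Real.abs_sin_le_one θ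
      have h3 : 0 ≤ M := (abs_nonneg _).trans h1
      calc _ ≤ M * (D * 1) := by gcongr
        _ = _ := by ring) n
  refine ⟨P.comp (Polynomial.C D⁻¹ * Polynomial.X), ?_, fun x hx => ?_⟩
  · refine Polynomial.natDegree_comp_le.trans ?_
    calc _ ≤ P.natDegree * 1 := Nat.mul_le_mul_left _
          ((Polynomial.natDegree_C_mul_le _ _).trans Polynomial.natDegree_X_le)
      _ ≤ n := by omega
  · have hx1 : -1 ≤ D⁻¹ * x := by
      rw [← div_eq_inv_mul, le_div_iff₀ hD]; linarith [hx.1]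
    have hx2 : D⁻¹ * x ≤ 1 := by
      rw [← div_eq_inv_mul, div_le_iff₀ hD]; linarith [hx.2]
    have := hPG (Real.arccos (D⁻¹ * x))
    rw [Real.cos_arccos hx1 hx2, mul_inv_cancel_left₀ hD.ne'] at this
    simp only [Polynomial.eval_comp, Polynomial.eval_mul, Polynomial.eval_C, Polynomial.eval_X]
    refine this.trans (le_of_eq ?_)
    field_simp

theorem exists_polynomial_derivative_eq (Q : Polynomial ℝ) :
    ∃ P : Polynomial ℝ, P.derivative = Q ∧ P.natDegree ≤ Q.natDegree + 1 := by
  refine ⟨∑ i ∈ Finset.range (Q.natDegree + 1),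
    Polynomial.monomial (i + 1) (Q.coeff i / (i + 1)), ?_, ?_⟩
  · rw [Polynomial.derivative_sum]
    conv_rhs => rw [Q.as_sum_range]
    refine Finset.sum_congr rfl fun i _ => ?_
    rw [Polynomial.derivative_monomial]
    have : (i : ℝ) + 1 ≠ 0 := by positivity
    push_cast
    rw [div_mul_cancel₀ _ this]
  · refine Polynomial.natDegree_sum_le_of_forall_le _ _ fun i hi => ?_
    refine (Polynomial.natDegree_monomial_le _).trans ?_
    have := Finset.mem_range.1 hi
    omega

/-- Jackson's theorem with Favard's constant: on `[-D, D]`, a `C^k` function with `k`-th derivative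
bounded by `M` is within `(π D / 2)^k M / ((n + 1) n ⋯ (n - k + 2))` of a polynomial of degree at
most `n ≥ k`. The step from `k` to `k + 1` subtracts an antiderivative of a polynomial close to
`f'`. -/
theorem exists_polynomial_near_of_iteratedDeriv_le {D M : ℝ} (hD : 0 ≤ D) (k : ℕ) :
    ∀ {f : ℝ → ℝ} {n : ℕ}, ContDiff ℝ k f → k ≤ n →
      (∀ x ∈ Set.Icc (-D) D, |iteratedDeriv k f x| ≤ M) →
      ∃ P : Polynomial ℝ, P.natDegree ≤ n ∧ ∀ x ∈ Set.Icc (-D) D,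
        |f x - P.eval x| ≤ (Real.pi / 2 * D) ^ k *
          ((Nat.factorial (n - k + 1) : ℝ) / Nat.factorial (n + 1)) * M := by
  induction k with
  | zero =>
    intro f n _ _ hM
    refine ⟨0, by simp, fun x hx => ?_⟩
    have := hM x hx
    have h0 : ((n + 1).factorial : ℝ) ≠ 0 := by exact_mod_cast (n + 1).factorial_ne_zero
    simpa [div_self h0] using this
  | succ k ih =>
    intro f n hf hkn hM
    obtain ⟨n, rfl⟩ : ∃ m, n = m + 1 := ⟨n - 1, by omega⟩
    have hf1 : ContDiff ℝ 1 f := hf.of_le (by norm_cast; omega)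
    have hf' : ContDiff ℝ k (deriv f) := by
      have : ContDiff ℝ ((k : WithTop ℕ∞) + 1) f := by exact_mod_cast hf
      exact (contDiff_succ_iff_deriv.1 this).2.2
    obtain ⟨Q, hQ, hQf⟩ := ih hf' (n := n) (by omega) (fun x hx => by
      rw [← iteratedDeriv_succ']; exact hM x hx)
    obtain ⟨R, hR, hRdeg⟩ := exists_polynomial_derivative_eq Q
    obtain ⟨S, hS, hSf⟩ := exists_polynomial_near_of_deriv_le
      (f := fun x => f x - R.eval x) (hf1.sub (by
        simpa only [Polynomial.coe_aeval_eq_eval] using! R.contDiff_aeval 1)) hD (fun x hx => by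
        have e : deriv (fun x => f x - R.eval x) x = deriv f x - Q.eval x := by
          rw [deriv_fun_sub (hf1.differentiable (by norm_num) x) (R.differentiable x),
            Polynomial.deriv, hR]
        rw [e]
        exact hQf x hx) (n + 1)
    refine ⟨R + S, (Polynomial.natDegree_add_le _ _).trans (max_le (by omega) hS),
      fun x hx => ?_⟩
    have := hSf x hx
    rw [Polynomial.eval_add, ← sub_sub]
    refine this.trans (le_of_eq ?_)
    rw [Nat.factorial_succ (n + 1), show n + 1 - (k + 1) = n - k by omega, pow_succ]
    push_cast
    have h0 : ((n + 1).factorial : ℝ) ≠ 0 := by exact_mod_cast (n + 1).factorial_ne_zero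
    field_simp

/-! ### Moments of measures on a bounded interval -/

/-- Even moments growing at most like those of a measure on `[-D, D]` force the support into
`[-D, D]`, by Markov's inequality for `x ^ (2 k)` and `k → ∞`. -/
theorem ae_abs_le_of_moments_le {μ : Measure ℝ} [IsFiniteMeasure μ] {D : ℝ} (hD : 0 ≤ D)
    (hint : ∀ k : ℕ, Integrable (fun s : ℝ => s ^ k) μ)
    (hmom : ∀ k : ℕ, ∫ s, s ^ (2 * k) ∂μ ≤ D ^ (2 * k)) : ∀ᵐ s ∂μ, |s| ≤ D := by
  have hnull : ∀ R, D < R → μ.real {s | R ≤ |s|} = 0 := by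
    intro R hR
    have hR0 : 0 < R := hD.trans_lt hR
    have hbound : ∀ k : ℕ, μ.real {s | R ≤ |s|} ≤ ((D / R) ^ 2) ^ k := by
      intro k
      have h1 := mul_meas_ge_le_integral_of_nonneg (μ := μ) (f := fun s : ℝ => s ^ (2 * k))
        (Filter.Eventually.of_forall fun s => Even.pow_nonneg (even_two_mul k) s)
        (hint (2 * k)) (R ^ (2 * k))
      have h2 : μ.real {s | R ≤ |s|} ≤ μ.real {s | R ^ (2 * k) ≤ s ^ (2 * k)} := by
        refine measureReal_mono fun s (hs : R ≤ |s|) => ?_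
        have := pow_le_pow_left₀ hR0.le hs (2 * k)
        rwa [Even.pow_abs (even_two_mul k)] at this
      rw [← pow_mul, div_pow, le_div_iff₀ (by positivity), mul_comm]
      exact (mul_le_mul_of_nonneg_left h2 (by positivity)).trans (h1.trans (hmom k))
    have hlim : Filter.Tendsto (fun k : ℕ => ((D / R) ^ 2) ^ k) Filter.atTop (nhds 0) := by
      refine tendsto_pow_atTop_nhds_zero_of_lt_one (by positivity) ?_
      have : D / R < 1 := (div_lt_one hR0).2 hR
      have h0 : 0 ≤ D / R := by positivity
      nlinarith
    exact le_antisymm (ge_of_tendsto' hlim hbound) measureReal_nonneg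
  have hae : ∀ n : ℕ, ∀ᵐ s ∂μ, |s| < D + 1 / ((n : ℝ) + 1) := by
    intro n
    rw [ae_iff]
    simp only [not_lt]
    exact (measureReal_eq_zero_iff).1 (hnull _ (by
      linarith [Nat.one_div_pos_of_nat (α := ℝ) (n := n)]))
  filter_upwards [ae_all_iff.2 hae] with s hs
  have hlim : Filter.Tendsto (fun n : ℕ => D + 1 / ((n : ℝ) + 1)) Filter.atTop (nhds (D + 0)) :=
    tendsto_one_div_add_atTop_nhds_zero_nat.const_add D
  rw [add_zero] at hlim
  exact ge_of_tendsto' hlim fun n => (hs n).le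

section Bounded

variable {μ ν : Measure ℝ} {D : ℝ}

theorem integrable_of_continuous_of_ae_abs_le [IsFiniteMeasure μ] (hμ : ∀ᵐ s ∂μ, |s| ≤ D)
    {f : ℝ → ℝ} (hf : Continuous f) : Integrable f μ := by
  obtain ⟨C, hC⟩ := (isCompact_Icc (a := -D) (b := D)).exists_bound_of_continuousOn
    hf.continuousOn
  refine Integrable.of_bound hf.aestronglyMeasurable C ?_
  filter_upwards [hμ] with s hs using hC s (abs_le.1 hs)

theorem integral_polynomial_eq_sum [IsFiniteMeasure μ] (hμ : ∀ᵐ s ∂μ, |s| ≤ D)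
    (P : Polynomial ℝ) {N : ℕ} (hN : P.natDegree < N) :
    ∫ s, P.eval s ∂μ = ∑ i ∈ Finset.range N, P.coeff i * ∫ s, s ^ i ∂μ := by
  simp only [Polynomial.eval_eq_sum_range' hN]
  rw [integral_finsetSum _ fun i _ =>
    integrable_of_continuous_of_ae_abs_le hμ (by fun_prop)]
  exact Finset.sum_congr rfl fun i _ => integral_const_mul _ _

theorem abs_integral_sub_integral_polynomial_le [IsProbabilityMeasure μ]
    (hμ : ∀ᵐ s ∂μ, |s| ≤ D) {f : ℝ → ℝ} (hf : Continuous f) {P : Polynomial ℝ} {ε : ℝ}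
    (hP : ∀ x ∈ Set.Icc (-D) D, |f x - P.eval x| ≤ ε) :
    |(∫ s, f s ∂μ) - ∫ s, P.eval s ∂μ| ≤ ε := by
  rw [← integral_sub (integrable_of_continuous_of_ae_abs_le hμ hf)
    (integrable_of_continuous_of_ae_abs_le hμ P.continuous), ← Real.norm_eq_abs]
  refine (norm_integral_le_of_norm_le_const (C := ε) ?_).trans (by simp)
  filter_upwards [hμ] with s hs using hP s (abs_le.1 hs)

/-- A measure on a bounded interval is determined by its moments. -/
theorem eq_of_moments_eq [IsProbabilityMeasure μ] [IsProbabilityMeasure ν]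
    (hμ : ∀ᵐ s ∂μ, |s| ≤ D) (hν : ∀ᵐ s ∂ν, |s| ≤ D)
    (h : ∀ k : ℕ, ∫ s, s ^ k ∂μ = ∫ s, s ^ k ∂ν) : μ = ν := by
  refine ext_of_forall_integral_eq_of_IsFiniteMeasure fun f => eq_of_forall_dist_le fun ε hε => ?_
  obtain ⟨P, hP⟩ := exists_polynomial_near_of_continuousOn (-D) D f f.continuous.continuousOn
    (ε / 2) (by positivity)
  have hP' : ∀ x ∈ Set.Icc (-D) D, |f x - P.eval x| ≤ ε / 2 := fun x hx => by
    rw [abs_sub_comm]; exact (hP x hx).le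
  have h1 := abs_integral_sub_integral_polynomial_le hμ f.continuous hP'
  have h2 := abs_integral_sub_integral_polynomial_le hν f.continuous hP'
  have h3 : ∫ s, P.eval s ∂μ = ∫ s, P.eval s ∂ν := by
    rw [integral_polynomial_eq_sum hμ P (Nat.lt_succ_self _),
      integral_polynomial_eq_sum hν P (Nat.lt_succ_self _)]
    simp only [h]
  rw [← h3] at h2
  rw [Real.dist_eq]
  rw [abs_le] at *
  constructor <;> linarith

/-- A pointwise limit of moment sequences of probability measures on `[-D, D]` is a moment sequence,
as these measures form a compact set. -/
theorem exists_measure_of_eventually_moments {μs : ℕ → Measure ℝ}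
    [∀ r, IsProbabilityMeasure (μs r)] (hμs : ∀ r, ∀ᵐ s ∂(μs r), |s| ≤ D) {m : ℕ → ℝ}
    (hm : ∀ k, ∀ᶠ r in Filter.atTop, ∫ s, s ^ k ∂(μs r) = m k) :
    ∃ μ : Measure ℝ, IsProbabilityMeasure μ ∧ (∀ᵐ s ∂μ, |s| ≤ D) ∧ ∀ k, ∫ s, s ^ k ∂μ = m k := by
  let K : Set ℝ := Set.Icc (-D) D
  have hKm : MeasurableSet K := measurableSet_Icc
  have hmap : ∀ r, ((μs r).comap (Subtype.val : K → ℝ)).map (Subtype.val : K → ℝ) = μs r := by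
    intro r
    rw [(MeasurableEmbedding.subtype_coe hKm).map_comap, Subtype.range_coe]
    refine Measure.restrict_eq_self_of_ae_mem ?_
    filter_upwards [hμs r] with s hs using abs_le.1 hs
  have hprob : ∀ r, IsProbabilityMeasure ((μs r).comap (Subtype.val : K → ℝ)) := by
    intro r
    have h1 : IsProbabilityMeasure
        (((μs r).comap (Subtype.val : K → ℝ)).map (Subtype.val : K → ℝ)) := by
      rw [hmap]; infer_instance
    refine ⟨?_⟩
    have := h1.measure_univ
    rwa [Measure.map_apply measurable_subtype_coe MeasurableSet.univ, Set.preimage_univ] at this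
  let νs : ℕ → ProbabilityMeasure K := fun r => ⟨_, hprob r⟩
  let U : Ultrafilter (ProbabilityMeasure K) := (Filter.hyperfilter ℕ).map νs
  obtain ⟨ν, -, hν⟩ := isCompact_univ.ultrafilter_le_nhds U (by simp)
  have hν' : Filter.Tendsto νs (Filter.hyperfilter ℕ : Filter ℕ) (nhds ν) := hν
  refine ⟨(ν : Measure K).map (Subtype.val : K → ℝ), Measure.isProbabilityMeasure_map
    measurable_subtype_coe.aemeasurable, ?_, fun k => ?_⟩
  · rw [ae_map_iff measurable_subtype_coe.aemeasurable
      (measurableSet_le measurable_abs measurable_const)]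
    exact Filter.Eventually.of_forall fun s => abs_le.2 s.2
  · have h1 := (ProbabilityMeasure.tendsto_iff_forall_integral_tendsto.1 hν')
      (BoundedContinuousFunction.mkOfCompact
        ⟨fun s : K => (s : ℝ) ^ k, continuous_subtype_val.pow k⟩)
    have h2 : ∀ r, ∫ s : K, (s : ℝ) ^ k ∂(νs r : Measure K) = ∫ s, s ^ k ∂(μs r) := by
      intro r
      conv_rhs => rw [← hmap r]
      rw [integral_map measurable_subtype_coe.aemeasurable (by fun_prop)]
      rfl
    simp only [BoundedContinuousFunction.mkOfCompact_apply, ContinuousMap.coe_mk, h2] at h1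
    rw [integral_map measurable_subtype_coe.aemeasurable (by fun_prop)]
    have hlt : (Filter.hyperfilter ℕ : Filter ℕ) ≤ Filter.atTop := by
      rw [← Nat.cofinite_eq_atTop]; exact Filter.hyperfilter_le_cofinite
    exact tendsto_nhds_unique h1 (tendsto_const_nhds.congr'
      (((hm k).filter_mono hlt).mono fun r hr => hr.symm))

end Bounded

section Family

variable {Ω : Type*} [MeasurableSpace Ω] {μ : Ω → Measure ℝ} {D : ℝ}

/-- A family of measures on `[-D, D]` with measurable moments is measurable. -/
theorem measurable_of_measurable_moments [∀ ω, IsProbabilityMeasure (μ ω)]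
    (hμ : ∀ ω, ∀ᵐ s ∂(μ ω), |s| ≤ D) (hmom : ∀ k : ℕ, Measurable fun ω => ∫ s, s ^ k ∂(μ ω)) :
    Measurable μ := by
  have hcont : ∀ f : ℝ → ℝ, Continuous f → Measurable fun ω => ∫ s, f s ∂(μ ω) := by
    intro f hf
    have hex : ∀ n : ℕ, ∃ P : Polynomial ℝ, ∀ x ∈ Set.Icc (-D) D,
        |P.eval x - f x| < 1 / ((n : ℝ) + 1) := fun n =>
      exists_polynomial_near_of_continuousOn (-D) D f hf.continuousOn _ (by positivity)
    choose P hP using hex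
    refine measurable_of_tendsto_metrizable (f := fun n ω => ∫ s, (P n).eval s ∂(μ ω))
      (fun n => ?_) (tendsto_pi_nhds.2 fun ω => ?_)
    · simp only [fun ω => integral_polynomial_eq_sum (hμ ω) (P n) (Nat.lt_succ_self _)]
      exact Finset.measurable_sum _ fun i _ => (hmom i).const_mul _
    · refine tendsto_iff_dist_tendsto_zero.2 (squeeze_zero (fun _ => dist_nonneg) (fun n => ?_)
        tendsto_one_div_add_atTop_nhds_zero_nat)
      rw [dist_comm, Real.dist_eq]
      exact abs_integral_sub_integral_polynomial_le (hμ ω) hf fun x hx => by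
        rw [abs_sub_comm]; exact (hP n x hx).le
  refine Measurable.measure_of_isPiSystem_of_isProbabilityMeasure
    (borel_eq_generateFrom_Iic ℝ ▸ BorelSpace.measurable_eq) isPiSystem_Iic ?_
  rintro _ ⟨a, rfl⟩
  have hpos : ∀ n : ℕ, (0 : ℝ) < 1 / ((n : ℝ) + 1) := fun n => by positivity
  have hreal : Measurable fun ω => (μ ω).real (Set.Iic a) :=
    measurable_of_tendsto_metrizable
      (f := fun n ω => ∫ s, (thickenedIndicator (hpos n) (Set.Iic a) s : ℝ) ∂(μ ω))
      (fun n => hcont _ (by fun_prop)) (tendsto_pi_nhds.2 fun ω =>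
        tendsto_integral_thickenedIndicator_of_isClosed _ isClosed_Iic hpos
          tendsto_one_div_add_atTop_nhds_zero_nat)
  simpa [measureReal_def, ENNReal.ofReal_toReal] using hreal.ennreal_ofReal

variable {P : Measure Ω}

theorem ae_abs_le_bind (hm : Measurable μ) (hμ : ∀ ω, ∀ᵐ s ∂(μ ω), |s| ≤ D) :
    ∀ᵐ s ∂(P.bind μ), |s| ≤ D := by
  have hs : MeasurableSet {s : ℝ | ¬|s| ≤ D} :=
    (measurableSet_le measurable_abs measurable_const).compl
  rw [ae_iff, Measure.bind_apply hs hm.aemeasurable]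
  simp only [fun ω => ae_iff.1 (hμ ω), lintegral_zero]

theorem integral_pow_bind [IsProbabilityMeasure P] [∀ ω, IsProbabilityMeasure (μ ω)]
    (hm : Measurable μ) (hμ : ∀ ω, ∀ᵐ s ∂(μ ω), |s| ≤ D) (k : ℕ) :
    ∫ s, s ^ k ∂(P.bind μ) = ∫ ω, ∫ s, s ^ k ∂(μ ω) ∂P := by
  let κ : Kernel Ω ℝ := ⟨μ, hm⟩
  have : IsProbabilityMeasure (P.bind μ) :=
    isProbabilityMeasure_bind hm.aemeasurable (Filter.Eventually.of_forall inferInstance)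
  have hint : Integrable (fun s : ℝ => s ^ k) (P.bind μ) :=
    integrable_of_continuous_of_ae_abs_le (ae_abs_le_bind hm hμ) (by fun_prop)
  have e : P.bind μ = (κ ∘ₖ Kernel.const Unit P) () := Measure.comp_eq_comp_const_apply (κ := κ)
  rw [e] at hint ⊢
  rw [Kernel.integral_comp hint, Kernel.const_apply]
  rfl

end Family

/-! ### Walk counts and spectral measures at a vertex -/

open Classical in
/-- The number of walks of length `j` from `x` to `y` in `H`. -/
noncomputable def walkCount {V : Type*} (H : SimpleGraph V) [H.LocallyFinite] (x : V) :
    ℕ → V → ℕ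
  | 0, y => if y = x then 1 else 0
  | j + 1, y => ∑ z ∈ H.neighborFinset y, walkCount H x j z

section WalkCount

variable {V : Type*} (H : SimpleGraph V) [H.LocallyFinite]

theorem adjOperator_apply (f : V →₀ ℂ) (y : V) :
    adjOperator H f y = ∑ z ∈ H.neighborFinset y, f z := by
  classical
  induction f using Finsupp.induction_linear with
  | zero => simp
  | add f g hf hg => simp [map_add, hf, hg, Finset.sum_add_distrib]
  | single z c =>
    rw [adjOperator, Finsupp.linearCombination_single, Finsupp.smul_apply, Finsupp.finsetSum_apply]
    simp only [Finsupp.single_apply, Finset.sum_ite_eq, Finset.sum_ite_eq',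
      SimpleGraph.mem_neighborFinset, H.adj_comm y z]
    simp

theorem adjOperator_pow_single (x : V) (j : ℕ) (y : V) :
    (adjOperator H ^ j) (Finsupp.single x 1) y = (walkCount H x j y : ℂ) := by
  classical
  induction j generalizing y with
  | zero => simp [walkCount, Finsupp.single_apply, eq_comm]
  | succ j ih =>
    rw [pow_succ', Module.End.mul_apply, adjOperator_apply, walkCount]
    push_cast
    exact Finset.sum_congr rfl fun z _ => ih z

theorem isSpectralMeasure_iff (x : V) (μ : Measure ℝ) :
    IsSpectralMeasure H x μ ↔ IsProbabilityMeasure μ ∧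
      ∀ k : ℕ, Integrable (fun s : ℝ => s ^ k) μ ∧ ∫ s : ℝ, s ^ k ∂μ = walkCount H x k x := by
  unfold IsSpectralMeasure
  simp only [adjOperator_pow_single]
  norm_cast

theorem walkCount_le_pow {D : ℕ} (hD : ∀ y, H.degree y ≤ D) (x : V) (j : ℕ) (y : V) :
    walkCount H x j y ≤ D ^ j := by
  induction j generalizing y with
  | zero => rw [walkCount]; split_ifs <;> simp
  | succ j ih =>
    rw [walkCount]
    calc _ ≤ (H.neighborFinset y).card • D ^ j := Finset.sum_le_card_nsmul _ _ _ fun z _ => ih z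
      _ ≤ D * D ^ j := by
        rw [smul_eq_mul, SimpleGraph.card_neighborFinset_eq_degree]
        exact Nat.mul_le_mul_right _ (hD y)
      _ = D ^ (j + 1) := by ring

variable {H}

theorem edist_le_of_walkCount_ne_zero {x y : V} {j : ℕ} (h : walkCount H x j y ≠ 0) :
    H.edist x y ≤ j := by
  induction j generalizing y with
  | zero =>
    rw [walkCount] at h
    have : y = x := by by_contra hne; simp [hne] at h
    simp [this]
  | succ j ih =>
    rw [walkCount] at h
    obtain ⟨z, hz, hne⟩ := Finset.exists_ne_zero_of_sum_ne_zero h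
    have h1 : H.edist z y = 1 := SimpleGraph.edist_eq_one_iff_adj.2
      ((H.mem_neighborFinset _ _).1 hz).symm
    calc H.edist x y ≤ H.edist x z + H.edist z y := SimpleGraph.edist_triangle
      _ ≤ j + 1 := by rw [h1]; gcongr; exact ih hne
      _ = _ := by push_cast; rfl

/-- Walks from the root `b` to `x` of length at most `2 h - dist (b, x)` stay in the ball of radius
`h`, so that they can be counted in any induced subgraph which contains this ball. -/
theorem walkCount_embedding {U : Type*} {B : SimpleGraph U} [B.LocallyFinite] (ι : B ↪g H)
    {b : U} {h : ℕ} (hball : ballSet H (ι b) h ⊆ Set.range ι) (j : ℕ) :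
    ∀ {r : ℕ} {x : U}, H.edist (ι b) (ι x) ≤ r → r + j ≤ 2 * h →
      walkCount H (ι b) j (ι x) = walkCount B b j x := by
  classical
  induction j with
  | zero => intro r x _ _; simp [walkCount]
  | succ j ih =>
    intro r x hr hrj
    have hdist : ∀ z, H.Adj (ι x) z → H.edist (ι b) z ≤ (r + 1 : ℕ) := by
      intro z hz
      calc H.edist (ι b) z ≤ H.edist (ι b) (ι x) + H.edist (ι x) z := SimpleGraph.edist_triangle
        _ ≤ r + 1 := by rw [SimpleGraph.edist_eq_one_iff_adj.2 hz]; gcongr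
        _ = _ := by push_cast; rfl
    rw [walkCount, walkCount]
    have hsub : (B.neighborFinset x).map ι.toEmbedding ⊆ H.neighborFinset (ι x) := by
      intro z hz
      obtain ⟨y, hy, rfl⟩ := Finset.mem_map.1 hz
      exact (H.mem_neighborFinset _ _).2 (ι.map_adj_iff.2 ((B.mem_neighborFinset _ _).1 hy))
    rw [← Finset.sum_subset hsub, Finset.sum_map]
    · refine Finset.sum_congr rfl fun y hy => ?_
      exact ih (hdist _ (ι.map_adj_iff.2 ((B.mem_neighborFinset _ _).1 hy))) (by omega)
    · intro z hz hz'
      by_contra hne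
      have hadj := (H.mem_neighborFinset _ _).1 hz
      have h1 := edist_le_of_walkCount_ne_zero hne
      have hzh : z ∈ ballSet H (ι b) h := by
        change H.edist (ι b) z ≤ h
        rcases le_total (r + 1) h with hrh | hrh
        · exact (hdist z hadj).trans (by exact_mod_cast hrh)
        · exact h1.trans (by exact_mod_cast (by omega : j ≤ h))
      obtain ⟨y, rfl⟩ := hball hzh
      exact hz' (Finset.mem_map.2 ⟨y, (B.mem_neighborFinset _ _).2 (ι.map_adj_iff.1 hadj), rfl⟩)

theorem finite_ballSet (x : V) (r : ℕ) : (ballSet H x r).Finite := by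
  induction r with
  | zero =>
    refine (Set.finite_singleton x).subset fun y hy => ?_
    have hy : H.edist x y ≤ (0 : ℕ) := hy
    exact (SimpleGraph.edist_eq_zero_iff.1 (nonpos_iff_eq_zero.1 hy)).symm
  | succ r ih =>
    refine (ih.union (ih.biUnion fun z _ => (H.neighborSet z).toFinite)).subset fun y hy => ?_
    have hy : H.edist x y ≤ (r + 1 : ℕ) := hy
    rcases lt_or_eq_of_le hy with hlt | heq
    · exact Or.inl (ENat.lt_natCast_add_one_iff.1 (by exact_mod_cast hlt) : H.edist x y ≤ r)
    · obtain ⟨w, hw⟩ := SimpleGraph.exists_walk_of_edist_eq_coe heq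
      refine Or.inr ?_
      have hnil : ¬ w.Nil := by
        intro hn
        rw [← SimpleGraph.Walk.length_eq_zero_iff] at hn
        omega
      refine Set.mem_biUnion (x := w.penultimate) ?_ (w.adj_penultimate hnil)
      refine (SimpleGraph.edist_le w.dropLast).trans ?_
      have : w.dropLast.length = r := by simp [hw]
      rw [this]

end WalkCount

section Finite

variable {V : Type*} [Fintype V] (H : SimpleGraph V)

open Classical in
/-- The spectral measure at `x` of a finite graph, `∑ |u_i(x)|² δ_{λ_i}` for an orthonormal basis
`u_i` of eigenvectors of the adjacency matrix. -/
noncomputable def vertexMeasure (x : V) : Measure ℝ :=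
  ∑ i : V, ENNReal.ofReal
    (‖(H.isHermitian_adjMatrix ℂ).eigenvectorUnitary.1 x i‖ ^ 2) •
      Measure.dirac ((H.isHermitian_adjMatrix ℂ).eigenvalues i)

open Classical in
theorem integrable_vertexMeasure (x : V) (f : ℝ → ℝ) : Integrable f (vertexMeasure H x) := by
  refine integrable_finsetSum_measure.2 fun i _ => ?_
  exact (integrable_dirac (by simp [enorm])).smul_measure ENNReal.ofReal_ne_top

open Classical in
theorem integral_vertexMeasure (x : V) (f : ℝ → ℝ) :
    ∫ s, f s ∂(vertexMeasure H x) =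
      ∑ i : V, ‖(H.isHermitian_adjMatrix ℂ).eigenvectorUnitary.1 x i‖ ^ 2 *
        f ((H.isHermitian_adjMatrix ℂ).eigenvalues i) := by
  rw [vertexMeasure, integral_finsetSum_measure]
  · refine Finset.sum_congr rfl fun i _ => ?_
    rw [integral_smul_measure, integral_dirac, ENNReal.toReal_ofReal (by positivity), smul_eq_mul]
  · exact fun i _ => (integrable_dirac (by simp [enorm])).smul_measure ENNReal.ofReal_ne_top

open Classical in
theorem adjMatrix_pow_apply [H.LocallyFinite] (x : V) (j : ℕ) (y : V) :
    (H.adjMatrix ℂ ^ j) y x = (walkCount H x j y : ℂ) := by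
  induction j generalizing y with
  | zero => simp [walkCount, Matrix.one_apply]
  | succ j ih =>
    rw [pow_succ', SimpleGraph.adjMatrix_mul_apply, walkCount]
    push_cast
    refine Finset.sum_congr (by ext; simp) fun z _ => ih z

theorem integral_pow_vertexMeasure [H.LocallyFinite] (x : V) (k : ℕ) :
    ∫ s, s ^ k ∂(vertexMeasure H x) = walkCount H x k x := by
  classical
  rw [integral_vertexMeasure]
  have h1 := adjMatrix_pow_apply H x k x
  rw [(H.isHermitian_adjMatrix ℂ).spectral_theorem, ← map_pow, Matrix.diagonal_pow,
    Unitary.conjStarAlgAut_apply, Matrix.mul_apply] at h1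
  rw [← Complex.ofReal_inj]
  push_cast
  rw [← h1]
  refine Finset.sum_congr rfl fun i _ => ?_
  rw [Matrix.mul_diagonal, Matrix.star_apply, mul_right_comm, RCLike.star_def, Complex.mul_conj']
  simp

theorem isProbabilityMeasure_vertexMeasure (x : V) : IsProbabilityMeasure (vertexMeasure H x) := by
  classical
  have h := integral_pow_vertexMeasure H x 0
  have hfin : IsFiniteMeasure (vertexMeasure H x) := by
    rw [vertexMeasure]
    have : ∀ i : V, IsFiniteMeasure (ENNReal.ofReal
      (‖(H.isHermitian_adjMatrix ℂ).eigenvectorUnitary.1 x i‖ ^ 2) •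
      Measure.dirac ((H.isHermitian_adjMatrix ℂ).eigenvalues i)) := fun i =>
        Measure.smul_finite _ ENNReal.ofReal_ne_top
    infer_instance
  simp only [pow_zero, integral_const, smul_eq_mul, mul_one, walkCount, if_true, Nat.cast_one] at h
  refine ⟨?_⟩
  rw [← ENNReal.toReal_eq_one_iff]
  exact h

theorem isSpectralMeasure_vertexMeasure [H.LocallyFinite] (x : V) :
    IsSpectralMeasure H x (vertexMeasure H x) :=
  (isSpectralMeasure_iff H x _).2 ⟨isProbabilityMeasure_vertexMeasure H x, fun k =>
    ⟨integrable_vertexMeasure H x _, integral_pow_vertexMeasure H x k⟩⟩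

open Classical in
theorem integral_empiricalSpectralMeasure (f : ℝ → ℝ) :
    ∫ s, f s ∂(empiricalSpectralMeasure H) = (Fintype.card V : ℝ)⁻¹ *
      ∑ i : V, f ((H.isHermitian_adjMatrix ℂ).eigenvalues i) := by
  rw [empiricalSpectralMeasure, integral_smul_measure, integral_finsetSum_measure]
  · simp
  · exact fun i _ => integrable_dirac (by simp [enorm])

/-- The empirical measure is the average of the spectral measures at the vertices. -/
theorem integral_empiricalSpectralMeasure_eq_average (f : ℝ → ℝ) :
    ∫ s, f s ∂(empiricalSpectralMeasure H) = (Fintype.card V : ℝ)⁻¹ *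
      ∑ x : V, ∫ s, f s ∂(vertexMeasure H x) := by
  classical
  rw [integral_empiricalSpectralMeasure]
  congr 1
  simp only [integral_vertexMeasure]
  rw [Finset.sum_comm]
  refine Finset.sum_congr rfl fun i _ => ?_
  rw [← Finset.sum_mul]
  have h : (star (H.isHermitian_adjMatrix ℂ).eigenvectorUnitary.1 *
      (H.isHermitian_adjMatrix ℂ).eigenvectorUnitary.1) i i = 1 := by
    rw [Unitary.coe_star_mul_self, Matrix.one_apply_eq]
  rw [Matrix.mul_apply] at h
  have h2 : ∑ x : V, ‖(H.isHermitian_adjMatrix ℂ).eigenvectorUnitary.1 x i‖ ^ 2 = 1 := by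
    rw [← Complex.ofReal_inj]
    push_cast
    rw [← h]
    refine Finset.sum_congr rfl fun x _ => ?_
    rw [Matrix.star_apply, RCLike.star_def, Complex.conj_mul']
  rw [h2, one_mul]

end Finite

section Exists

variable {V : Type*} {H : SimpleGraph V} [H.LocallyFinite] {D : ℕ}

theorem IsSpectralMeasure.ae_abs_le (hD : ∀ y, H.degree y ≤ D) {x : V} {μ : Measure ℝ}
    (h : IsSpectralMeasure H x μ) : ∀ᵐ s ∂μ, |s| ≤ (D : ℝ) := by
  obtain ⟨h1, h2⟩ := (isSpectralMeasure_iff H x μ).1 h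
  refine ae_abs_le_of_moments_le (Nat.cast_nonneg D) (fun k => (h2 k).1) fun k => ?_
  rw [(h2 _).2]
  exact_mod_cast walkCount_le_pow H hD x (2 * k) x

/-- A graph of bounded degree has exactly one spectral measure at each vertex. Existence follows by
approximation with finite balls around the vertex. -/
theorem existsUnique_isSpectralMeasure (hD : ∀ y, H.degree y ≤ D) (x : V) :
    ∃! μ : Measure ℝ, IsSpectralMeasure H x μ := by
  classical
  have hfin : ∀ r, Fintype (ballSet H x r) := fun r => (finite_ballSet x r).fintype
  let B : ∀ r, SimpleGraph (ballSet H x r) := fun r => H.induce (ballSet H x r)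
  let b : ∀ r, ballSet H x r := fun r => ⟨x, mem_ballSet_self H x r⟩
  let ι : ∀ r, B r ↪g H := fun r => SimpleGraph.Embedding.induce (ballSet H x r)
  have hmom : ∀ k r, k ≤ 2 * r →
      ∫ s, s ^ k ∂(vertexMeasure (B r) (b r)) = walkCount H x k x := by
    intro k r hkr
    rw [integral_pow_vertexMeasure]
    exact_mod_cast (walkCount_embedding (ι r) (b := b r) (h := r) (fun y hy => ⟨⟨y, hy⟩, rfl⟩) k
      (r := 0) (x := b r) (by simp) (by omega)).symm
  have hdeg : ∀ r (y : ballSet H x r), (B r).degree y ≤ D := by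
    intro r y
    refine le_trans ?_ (hD y)
    rw [← SimpleGraph.card_neighborFinset_eq_degree, ← SimpleGraph.card_neighborFinset_eq_degree,
      ← Finset.card_map (ι r).toEmbedding]
    refine Finset.card_le_card fun z hz => ?_
    obtain ⟨w, hw, rfl⟩ := Finset.mem_map.1 hz
    exact (H.mem_neighborFinset _ _).2 ((ι r).map_adj_iff.2
      ((SimpleGraph.mem_neighborFinset _ _ _).1 hw))
  have hprob : ∀ r, IsProbabilityMeasure (vertexMeasure (B r) (b r)) := fun r =>
    isProbabilityMeasure_vertexMeasure _ _
  obtain ⟨μ, hμ, hμD, hμm⟩ := exists_measure_of_eventually_moments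
    (μs := fun r => vertexMeasure (B r) (b r)) (D := D) (m := fun k => walkCount H x k x)
    (fun r => (isSpectralMeasure_vertexMeasure (B r) (b r)).ae_abs_le (hdeg r))
    (fun k => Filter.eventually_atTop.2 ⟨k, fun r hr => hmom k r (by omega)⟩)
  refine ⟨μ, (isSpectralMeasure_iff H x μ).2 ⟨hμ, fun k =>
    ⟨integrable_of_continuous_of_ae_abs_le hμD (by fun_prop), hμm k⟩⟩, fun ν hν => ?_⟩
  obtain ⟨hν1, hν2⟩ := (isSpectralMeasure_iff H x ν).1 hν
  exact eq_of_moments_eq (hν.ae_abs_le hD) hμD fun k => by rw [(hν2 k).2, hμm k]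

theorem isSpectralMeasure_spectralMeasure (hD : ∀ y, H.degree y ≤ D) (x : V) :
    IsSpectralMeasure H x (spectralMeasure H x) := by
  have h := existsUnique_isSpectralMeasure hD x
  rw [spectralMeasure, dif_pos h]
  exact h.choose_spec.1

end Exists

/-! ### Percolation and its expected spectral measure -/

instance {V : Type*} (G : SimpleGraph V) (p : unitInterval) :
    IsProbabilityMeasure (percMeasure G p) := by
  unfold percMeasure; infer_instance

section Perc

variable {V : Type*} {H : SimpleGraph V}

theorem perc_le (ω : H.edgeSet → Bool) : perc H ω ≤ H := fun _ _ h => h.1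

theorem degree_perc_le [H.LocallyFinite] (ω : H.edgeSet → Bool) (x : V) :
    (perc H ω).degree x ≤ H.degree x := by
  rw [← SimpleGraph.card_neighborFinset_eq_degree, ← SimpleGraph.card_neighborFinset_eq_degree]
  refine Finset.card_le_card fun y hy => ?_
  exact (H.mem_neighborFinset _ _).2 (perc_le ω ((SimpleGraph.mem_neighborFinset _ _ _).1 hy))

theorem measurableSet_perc_adj (x y : V) :
    MeasurableSet {ω : H.edgeSet → Bool | (perc H ω).Adj x y} := by
  by_cases hxy : s(x, y) ∈ H.edgeSet
  · have : {ω : H.edgeSet → Bool | (perc H ω).Adj x y} =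
        (fun ω => ω ⟨s(x, y), hxy⟩) ⁻¹' {true} := by
      ext ω
      exact ⟨fun h => h.2, fun h => ⟨hxy, h⟩⟩
    rw [this]
    exact measurable_pi_apply _ (measurableSet_singleton _)
  · have : {ω : H.edgeSet → Bool | (perc H ω).Adj x y} = ∅ := by
      ext ω
      exact ⟨fun h => absurd h.1 hxy, fun h => h.elim⟩
    rw [this]
    exact MeasurableSet.empty

theorem measurable_walkCount_perc [H.LocallyFinite] (x : V) (j : ℕ) (y : V) :
    Measurable fun ω : H.edgeSet → Bool => walkCount (perc H ω) x j y := by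
  classical
  induction j generalizing y with
  | zero => exact measurable_const
  | succ j ih =>
    have e : ∀ ω, walkCount (perc H ω) x (j + 1) y =
        ∑ z ∈ H.neighborFinset y, if (perc H ω).Adj y z then walkCount (perc H ω) x j z else 0 := by
      intro ω
      rw [walkCount, ← Finset.sum_filter]
      refine Finset.sum_congr ?_ fun _ _ => rfl
      ext z
      simp only [SimpleGraph.mem_neighborFinset, Finset.mem_filter]
      exact ⟨fun h => ⟨perc_le ω h, h⟩, fun h => h.2⟩
    simp only [e]
    exact Finset.measurable_sum _ fun z _ =>
      Measurable.ite (measurableSet_perc_adj y z) (ih z) measurable_const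

variable [H.LocallyFinite] {D : ℕ} (p : unitInterval)

theorem isSpectralMeasure_spectralMeasure_perc (hD : ∀ y, H.degree y ≤ D) (x : V)
    (ω : H.edgeSet → Bool) :
    IsSpectralMeasure (perc H ω) x (spectralMeasure (perc H ω) x) :=
  isSpectralMeasure_spectralMeasure (fun y => (degree_perc_le ω y).trans (hD y)) x

/-- The mean spectral measure of percolation on a graph of degree at most `D` is a probability
measure on `[-D, D]`, whose moments are the expected numbers of closed walks. -/
theorem expectedSpectralMeasure_spec (hD : ∀ y, H.degree y ≤ D) (x : V) :
    IsProbabilityMeasure (expectedSpectralMeasure H p x) ∧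
      (∀ᵐ s ∂(expectedSpectralMeasure H p x), |s| ≤ (D : ℝ)) ∧
      ∀ k : ℕ, ∫ s, s ^ k ∂(expectedSpectralMeasure H p x) =
        ∫ ω, (walkCount (perc H ω) x k x : ℝ) ∂(percMeasure H p) := by
  have hspec := isSpectralMeasure_spectralMeasure_perc hD x
  have hprob : ∀ ω, IsProbabilityMeasure (spectralMeasure (perc H ω) x) := fun ω => (hspec ω).1
  have hae : ∀ ω, ∀ᵐ s ∂(spectralMeasure (perc H ω) x), |s| ≤ (D : ℝ) := fun ω =>
    (hspec ω).ae_abs_le fun y => (degree_perc_le ω y).trans (hD y)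
  have hmom : ∀ k ω, ∫ s, s ^ k ∂(spectralMeasure (perc H ω) x) = walkCount (perc H ω) x k x :=
    fun k ω => (((isSpectralMeasure_iff _ _ _).1 (hspec ω)).2 k).2
  have hmeas : Measurable fun ω => spectralMeasure (perc H ω) x := by
    refine measurable_of_measurable_moments hae fun k => ?_
    simp only [hmom]
    exact measurable_from_nat.comp (measurable_walkCount_perc x k x)
  refine ⟨isProbabilityMeasure_bind hmeas.aemeasurable (Filter.Eventually.of_forall hprob),
    ae_abs_le_bind hmeas hae, fun k => ?_⟩
  rw [expectedSpectralMeasure, integral_pow_bind hmeas hae]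
  simp only [hmom]

end Perc

section Coupling

variable {U V : Type*} {B : SimpleGraph U} {H : SimpleGraph V}

/-- Percolation on `H`, restricted to the edges of an embedded graph `B`, is percolation on `B`. -/
theorem percMeasure_map_embedding (ι : B ↪g H) (p : unitInterval) :
    (percMeasure H p).map (fun ω e => ω (ι.mapEdgeSet e)) = percMeasure B p := by
  refine Measure.eq_infinitePi _ fun s t ht => ?_
  have hm : Measurable fun (ω : H.edgeSet → Bool) (e : B.edgeSet) => ω (ι.mapEdgeSet e) :=
    measurable_pi_lambda _ fun e => measurable_pi_apply _
  rw [Measure.map_apply hm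
    (MeasurableSet.pi s.countable_toSet fun _ _ => MeasurableSet.of_discrete)]
  have hpre : (fun (ω : H.edgeSet → Bool) (e : B.edgeSet) => ω (ι.mapEdgeSet e)) ⁻¹'
      (Set.pi s t) = Set.pi (s.map ι.mapEdgeSet)
        (Function.extend ι.mapEdgeSet t fun _ => Set.univ) := by
    ext ω
    simp only [Set.mem_preimage, Set.mem_pi, Finset.coe_map, Set.forall_mem_image,
      ι.mapEdgeSet.injective.extend_apply]
  rw [hpre, percMeasure, Measure.infinitePi_pi _ fun _ _ => MeasurableSet.of_discrete,
    Finset.prod_map]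
  exact Finset.prod_congr rfl fun e _ => by rw [ι.mapEdgeSet.injective.extend_apply]

/-- An embedding of graphs restricts to percolated graphs if the configurations correspond. -/
def percEmbedding (ι : B ↪g H) (ω : H.edgeSet → Bool) :
    perc B (fun e => ω (ι.mapEdgeSet e)) ↪g perc H ω where
  toEmbedding := ι.toEmbedding
  map_rel_iff' {x y} := by
    constructor
    · rintro ⟨h, hω⟩
      exact ⟨ι.map_adj_iff.1 h, hω⟩
    · rintro ⟨h, hω⟩
      exact ⟨ι.map_adj_iff.2 h, hω⟩

/-- The expected number of closed walks of length at most `2 h` in a percolated graph depends only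
on the ball of radius `h`. -/
theorem integral_walkCount_perc_eq [B.LocallyFinite] [H.LocallyFinite] (ι : B ↪g H)
    (p : unitInterval) {b : U} {h k : ℕ} (hball : ballSet H (ι b) h ⊆ Set.range ι)
    (hk : k ≤ 2 * h) :
    ∫ ω, (walkCount (perc H ω) (ι b) k (ι b) : ℝ) ∂(percMeasure H p) =
      ∫ ω, (walkCount (perc B ω) b k b : ℝ) ∂(percMeasure B p) := by
  have hm : Measurable fun (ω : H.edgeSet → Bool) (e : B.edgeSet) => ω (ι.mapEdgeSet e) :=
    measurable_pi_lambda _ fun e => measurable_pi_apply _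
  have hc : Measurable fun ω : B.edgeSet → Bool => (walkCount (perc B ω) b k b : ℝ) :=
    measurable_from_nat.comp (measurable_walkCount_perc b k b)
  rw [← percMeasure_map_embedding ι p, integral_map hm.aemeasurable hc.aestronglyMeasurable]
  refine integral_congr_ae (Filter.Eventually.of_forall fun ω => congrArg (Nat.cast : ℕ → ℝ) ?_)
  have hsub : ballSet (perc H ω) (ι b) h ⊆ Set.range ι := fun y hy =>
    hball ((SimpleGraph.edist_anti (perc_le ω)).trans hy)
  exact walkCount_embedding (percEmbedding ι ω) (b := b) (h := h) hsub k (r := 0)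
    (x := b) (by change (perc H ω).edist (ι b) (ι b) ≤ _; simp) (by omega)

end Coupling

section Compare

variable {V W : Type*} {G : SimpleGraph V} {Γ : SimpleGraph W} [G.LocallyFinite] [Γ.LocallyFinite]
  {v : V} {o : W} {h : ℕ}

theorem RootedBallIso.integral_walkCount_eq (hiso : RootedBallIso G v Γ o h) (p : unitInterval)
    {k : ℕ} (hk : k ≤ 2 * h) :
    ∫ ω, (walkCount (perc G ω) v k v : ℝ) ∂(percMeasure G p) =
      ∫ ω, (walkCount (perc Γ ω) o k o : ℝ) ∂(percMeasure Γ p) := by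
  classical
  obtain ⟨f, hf⟩ := hiso
  have hfin : Fintype (ballSet G v h) := (finite_ballSet v h).fintype
  let ι₁ : G.induce (ballSet G v h) ↪g G := SimpleGraph.Embedding.induce _
  let ι₂ : G.induce (ballSet G v h) ↪g Γ :=
    (SimpleGraph.Embedding.induce (ballSet Γ o h)).comp f.toEmbedding
  let b : ballSet G v h := ⟨v, mem_ballSet_self G v h⟩
  have h2 : ι₂ b = o := congrArg Subtype.val hf
  have e1 := integral_walkCount_perc_eq ι₁ p (b := b) (h := h) (fun y hy => ⟨⟨y, hy⟩, rfl⟩) hk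
  have e2 := integral_walkCount_perc_eq ι₂ p (b := b) (h := h) (by
    rw [h2]
    intro y hy
    exact ⟨f.symm ⟨y, hy⟩, congrArg Subtype.val (f.apply_symm_apply ⟨y, hy⟩)⟩) hk
  rw [h2] at e2
  exact e1.trans e2.symm

theorem RootedBallIso.degree_le (hiso : RootedBallIso G v Γ o h) (hh : 1 ≤ h) :
    Γ.degree o ≤ G.degree v := by
  classical
  obtain ⟨f, hf⟩ := hiso
  have hball : ∀ z, Γ.Adj o z → z ∈ ballSet Γ o h := fun z hz => by
    change Γ.edist o z ≤ h
    rw [SimpleGraph.edist_eq_one_iff_adj.2 hz]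
    exact_mod_cast hh
  have hf' : f.symm ⟨o, mem_ballSet_self Γ o h⟩ = ⟨v, mem_ballSet_self G v h⟩ := by
    rw [← hf, f.symm_apply_apply]
  rw [← SimpleGraph.card_neighborFinset_eq_degree, ← SimpleGraph.card_neighborFinset_eq_degree]
  refine Finset.card_le_card_of_injOn
    (fun z => if hz : z ∈ ballSet Γ o h then (f.symm ⟨z, hz⟩ : V) else v) (fun z hz => ?_) ?_
  · have hz := (Γ.mem_neighborFinset _ _).1 hz
    simp only [dif_pos (hball z hz)]
    refine (G.mem_neighborFinset _ _).2 ?_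
    have hadj : (Γ.induce (ballSet Γ o h)).Adj ⟨o, mem_ballSet_self Γ o h⟩ ⟨z, hball z hz⟩ := hz
    have := f.symm.map_adj_iff.2 hadj
    rw [hf'] at this
    exact this
  · intro z hz w hw hzw
    have hz := hball z ((Γ.mem_neighborFinset _ _).1 hz)
    have hw := hball w ((Γ.mem_neighborFinset _ _).1 hw)
    simp only [dif_pos hz, dif_pos hw] at hzw
    exact congrArg Subtype.val (f.symm.injective (Subtype.ext hzw))

theorem IsVertexTransitive.degree_eq (hΓ : IsVertexTransitive Γ) (x y : W) :
    Γ.degree x = Γ.degree y := by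
  obtain ⟨f, rfl⟩ := hΓ x y
  exact (f.degree_eq x).symm

end Compare

/-! ### Eigenvalues under a perturbation at one vertex -/

section Perturbation

variable {V : Type*} [Fintype V]

open Matrix in
theorem star_dotProduct_mulVec_eq_sum [DecidableEq V] {A : Matrix V V ℂ} (hA : A.IsHermitian)
    (u : V → ℂ) :
    star u ⬝ᵥ (A *ᵥ u) = ((∑ i, hA.eigenvalues i *
      ‖(star hA.eigenvectorUnitary.1 *ᵥ u) i‖ ^ 2 : ℝ) : ℂ) := by
  conv_lhs => rw [hA.spectral_theorem, Unitary.conjStarAlgAut_apply]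
  rw [← mulVec_mulVec, ← mulVec_mulVec, dotProduct_mulVec]
  have h : star u ᵥ* hA.eigenvectorUnitary.1 = star (star hA.eigenvectorUnitary.1 *ᵥ u) := by
    rw [star_mulVec, star_eq_conjTranspose, conjTranspose_conjTranspose]
  rw [h, dotProduct]
  push_cast
  refine Finset.sum_congr rfl fun i _ => ?_
  rw [mulVec_diagonal, Pi.star_apply, ← Complex.conj_mul', RCLike.star_def]
  simp only [Function.comp_apply, Complex.coe_algebraMap]
  ring

open Matrix in
theorem star_dotProduct_self_eq_sum [DecidableEq V] {A : Matrix V V ℂ} (hA : A.IsHermitian)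
    (u : V → ℂ) :
    star u ⬝ᵥ u = ((∑ i, ‖(star hA.eigenvectorUnitary.1 *ᵥ u) i‖ ^ 2 : ℝ) : ℂ) := by
  have h : star u ⬝ᵥ u = star (star hA.eigenvectorUnitary.1 *ᵥ u) ⬝ᵥ
      (star hA.eigenvectorUnitary.1 *ᵥ u) := by
    rw [star_mulVec, star_eq_conjTranspose, conjTranspose_conjTranspose, ← dotProduct_mulVec,
      mulVec_mulVec, ← star_eq_conjTranspose,
      Unitary.mul_star_self_of_mem hA.eigenvectorUnitary.2, one_mulVec]
  rw [h, dotProduct]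
  push_cast
  refine Finset.sum_congr rfl fun i _ => ?_
  rw [Pi.star_apply, RCLike.star_def, Complex.conj_mul']

open Matrix in
/-- If two Hermitian matrices agree off the row and the column of `v`, then at most one more
eigenvalue of the first one than of the second one is less than `t`: otherwise there is a vector
`u ≠ 0` with `u v = 0` at which the two quadratic forms agree, the first one being less than
`t ‖u‖²`, the second one at least `t ‖u‖²`. -/
theorem card_eigenvalues_lt_le [DecidableEq V] {A B : Matrix V V ℂ}
    (hA : A.IsHermitian) (hB : B.IsHermitian)
    {v : V} (hAB : ∀ x y, x ≠ v → y ≠ v → A x y = B x y) (t : ℝ) :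
    (Finset.univ.filter fun i => hA.eigenvalues i < t).card ≤
      (Finset.univ.filter fun i => hB.eigenvalues i < t).card + 1 := by
  by_contra hlt
  let L : (V → ℂ) →ₗ[ℂ]
      (({i // ¬ hA.eigenvalues i < t} → ℂ) × ({i // hB.eigenvalues i < t} → ℂ)) × ℂ :=
    ((LinearMap.funLeft ℂ ℂ Subtype.val ∘ₗ (star hA.eigenvectorUnitary.1).mulVecLin).prod
      (LinearMap.funLeft ℂ ℂ Subtype.val ∘ₗ (star hB.eigenvectorUnitary.1).mulVecLin)).prod
        (LinearMap.proj v)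
  have hdim : Module.finrank ℂ ((({i // ¬ hA.eigenvalues i < t} → ℂ) ×
      ({i // hB.eigenvalues i < t} → ℂ)) × ℂ) < Module.finrank ℂ (V → ℂ) := by
    rw [Module.finrank_prod, Module.finrank_prod, Module.finrank_self, Module.finrank_pi,
      Module.finrank_pi, Module.finrank_pi, Fintype.card_subtype_compl, Fintype.card_subtype,
      Fintype.card_subtype]
    have := Finset.card_le_univ (Finset.univ.filter fun i => hA.eigenvalues i < t)
    omega
  obtain ⟨u, hu, hu0⟩ := Submodule.exists_mem_ne_zero_of_ne_bot
    (LinearMap.ker_ne_bot_of_finrank_lt (f := L) hdim)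
  have hL : L u = 0 := hu
  have huA : ∀ i, ¬ hA.eigenvalues i < t → (star hA.eigenvectorUnitary.1 *ᵥ u) i = 0 :=
    fun i hi => congrFun (congrArg (fun z => z.1.1) hL) ⟨i, hi⟩
  have huB : ∀ i, hB.eigenvalues i < t → (star hB.eigenvectorUnitary.1 *ᵥ u) i = 0 :=
    fun i hi => congrFun (congrArg (fun z => z.1.2) hL) ⟨i, hi⟩
  have huv : u v = 0 := congrArg (fun z => z.2) hL
  have hform : star u ⬝ᵥ (A *ᵥ u) = star u ⬝ᵥ (B *ᵥ u) := by
    simp only [dotProduct, mulVec, Finset.mul_sum]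
    refine Finset.sum_congr rfl fun x _ => Finset.sum_congr rfl fun y _ => ?_
    by_cases hx : x = v
    · simp [hx, huv]
    by_cases hy : y = v
    · simp [hy, huv]
    rw [hAB x y hx hy]
  have hself := (star_dotProduct_self_eq_sum hA u).symm.trans (star_dotProduct_self_eq_sum hB u)
  rw [star_dotProduct_mulVec_eq_sum hA, star_dotProduct_mulVec_eq_sum hB] at hform
  rw [Complex.ofReal_inj] at hself hform
  have h1 : ∑ i, hA.eigenvalues i * ‖(star hA.eigenvectorUnitary.1 *ᵥ u) i‖ ^ 2 <
      ∑ i, t * ‖(star hA.eigenvectorUnitary.1 *ᵥ u) i‖ ^ 2 := by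
    have hne : star hA.eigenvectorUnitary.1 *ᵥ u ≠ 0 := by
      intro h0
      have hu' : hA.eigenvectorUnitary.1 *ᵥ (star hA.eigenvectorUnitary.1 *ᵥ u) = u := by
        rw [mulVec_mulVec, Unitary.mul_star_self_of_mem hA.eigenvectorUnitary.2, one_mulVec]
      rw [h0, mulVec_zero] at hu'
      exact hu0 hu'.symm
    obtain ⟨i, hi⟩ := Function.ne_iff.1 hne
    refine Finset.sum_lt_sum (fun j _ => ?_) ⟨i, Finset.mem_univ _, ?_⟩
    · by_cases hj : hA.eigenvalues j < t
      · gcongr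
      · simp [huA j hj]
    · have hit : hA.eigenvalues i < t := by
        by_contra h
        exact hi (huA i h)
      have : 0 < ‖(star hA.eigenvectorUnitary.1 *ᵥ u) i‖ := norm_pos_iff.2 hi
      gcongr
  have h2 : ∑ i, t * ‖(star hB.eigenvectorUnitary.1 *ᵥ u) i‖ ^ 2 ≤
      ∑ i, hB.eigenvalues i * ‖(star hB.eigenvectorUnitary.1 *ᵥ u) i‖ ^ 2 := by
    refine Finset.sum_le_sum fun j _ => ?_
    by_cases hj : hB.eigenvalues j < t
    · simp [huB j hj]
    · have := not_lt.1 hj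
      gcongr
  rw [← Finset.mul_sum] at h1 h2
  rw [hself] at h1
  linarith

theorem sub_eq_integral_indicator {φ : ℝ → ℝ} (hφ : ContDiff ℝ 1 φ) {x R : ℝ} (hx : x ≤ R) :
    φ R - φ x = ∫ s, (Set.Ioc x R).indicator (deriv φ) s := by
  rw [integral_indicator measurableSet_Ioc, ← intervalIntegral.integral_of_le hx,
    intervalIntegral.integral_deriv_eq_sub' φ rfl
      (fun s _ => hφ.differentiable (by norm_num) s) (hφ.continuous_deriv le_rfl).continuousOn]

/-- Two finite families of reals of the same size, whose counting functions differ by at most `1`,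
have sums of `φ` which differ by at most the total variation of `φ`. -/
theorem abs_sum_sub_sum_le_tvNorm {φ : ℝ → ℝ} (hφ : ContDiff ℝ 1 φ)
    (hφ' : Integrable (deriv φ)) {a b : V → ℝ}
    (hab : ∀ t, (Finset.univ.filter fun i => a i < t).card ≤
      (Finset.univ.filter fun i => b i < t).card + 1)
    (hba : ∀ t, (Finset.univ.filter fun i => b i < t).card ≤
      (Finset.univ.filter fun i => a i < t).card + 1) :
    |∑ i, φ (a i) - ∑ i, φ (b i)| ≤ tvNorm φ := by
  obtain ⟨R, hR⟩ : ∃ R, ∀ i, a i ≤ R ∧ b i ≤ R := by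
    obtain ⟨R₁, h₁⟩ := (Set.finite_range a).bddAbove
    obtain ⟨R₂, h₂⟩ := (Set.finite_range b).bddAbove
    exact ⟨max R₁ R₂, fun i => ⟨(h₁ ⟨i, rfl⟩).trans (le_max_left _ _),
      (h₂ ⟨i, rfl⟩).trans (le_max_right _ _)⟩⟩
  have hint : ∀ x, Integrable ((Set.Ioc x R).indicator (deriv φ)) := fun x =>
    hφ'.indicator measurableSet_Ioc
  have hsum : ∀ c : V → ℝ, (∀ i, c i ≤ R) → ∑ i, (φ R - φ (c i)) =
      ∫ s, ∑ i, (Set.Ioc (c i) R).indicator (deriv φ) s := by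
    intro c hc
    rw [integral_finsetSum _ fun i _ => hint (c i)]
    exact Finset.sum_congr rfl fun i _ => sub_eq_integral_indicator hφ (hc i)
  have hcount : ∀ (c : V → ℝ) (s : ℝ), s ≤ R →
      ∑ i, (Set.Ioc (c i) R).indicator (deriv φ) s =
        (Finset.univ.filter fun i => c i < s).card * deriv φ s := by
    intro c s hs
    simp only [Set.indicator_apply, Set.mem_Ioc, hs, and_true]
    rw [← Finset.sum_filter, Finset.sum_const, nsmul_eq_mul]
  have e : ∑ i, φ (a i) - ∑ i, φ (b i) =
      ∫ s, (∑ i, (Set.Ioc (b i) R).indicator (deriv φ) s -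
        ∑ i, (Set.Ioc (a i) R).indicator (deriv φ) s) := by
    rw [integral_sub (integrable_finsetSum _ fun i _ => hint _)
      (integrable_finsetSum _ fun i _ => hint _), ← hsum a fun i => (hR i).1,
      ← hsum b fun i => (hR i).2, Finset.sum_sub_distrib, Finset.sum_sub_distrib]
    ring
  rw [e, tvNorm, ← Real.norm_eq_abs]
  refine norm_integral_le_of_norm_le hφ'.abs (Filter.Eventually.of_forall fun s => ?_)
  by_cases hs : s ≤ R
  · rw [hcount a s hs, hcount b s hs, ← sub_mul, norm_mul, Real.norm_eq_abs, Real.norm_eq_abs]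
    refine mul_le_of_le_one_left (abs_nonneg _) (abs_le.2 ⟨?_, ?_⟩)
    · have : ((Finset.univ.filter fun i => a i < s).card : ℝ) ≤
        (Finset.univ.filter fun i => b i < s).card + 1 := by exact_mod_cast hab s
      linarith
    · have : ((Finset.univ.filter fun i => b i < s).card : ℝ) ≤
        (Finset.univ.filter fun i => a i < s).card + 1 := by exact_mod_cast hba s
      linarith
  · simp [hs]

end Perturbation

/-- Changing the edges at one vertex changes the integral of `φ` against the empirical measure by
at most `‖φ‖_TV / n`. -/
theorem abs_integral_empirical_sub_le {V : Type*} [Fintype V] {φ : ℝ → ℝ} (hφ : ContDiff ℝ 1 φ)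
    (hφ' : Integrable (deriv φ)) {H K : SimpleGraph V} {v : V}
    (hHK : ∀ x y, x ≠ v → y ≠ v → (H.Adj x y ↔ K.Adj x y)) :
    |(∫ s, φ s ∂(empiricalSpectralMeasure H)) - ∫ s, φ s ∂(empiricalSpectralMeasure K)| ≤
      tvNorm φ / Fintype.card V := by
  classical
  rw [integral_empiricalSpectralMeasure, integral_empiricalSpectralMeasure, ← mul_sub, abs_mul,
    abs_of_nonneg (by positivity), div_eq_inv_mul]
  refine mul_le_mul_of_nonneg_left ?_ (by positivity)
  have hadj : ∀ x y, x ≠ v → y ≠ v → H.adjMatrix ℂ x y = K.adjMatrix ℂ x y := by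
    intro x y hx hy
    simp only [SimpleGraph.adjMatrix_apply, hHK x y hx hy]
  exact abs_sum_sub_sum_le_tvNorm hφ hφ'
    (fun t => card_eigenvalues_lt_le _ _ hadj t)
    (fun t => card_eigenvalues_lt_le _ _ (fun x y hx hy => (hadj x y hx hy).symm) t)

/-! ### Concentration for functions of independent blocks -/

section Concentration

variable {E V : Type*} {β : E → V}

open Classical in
/-- The configuration `ω` with the coordinates in the block of `v` replaced by those of `ω'`. -/
noncomputable def resample (β : E → V) (v : V) (ω ω' : E → Bool) : E → Bool :=
  fun e => if β e = v then ω' e else ω e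

theorem resample_of_ne {v : V} {ω ω' : E → Bool} {e : E} (h : β e ≠ v) :
    resample β v ω ω' e = ω e := if_neg h

theorem resample_congr {v : V} {ω₁ ω₂ ω' : E → Bool} {e : E} (h : β e ≠ v → ω₁ e = ω₂ e) :
    resample β v ω₁ ω' e = resample β v ω₂ ω' e := by
  unfold resample
  split_ifs with hv
  · rfl
  · exact h hv

variable (m : E → Measure Bool) [∀ e, IsProbabilityMeasure (m e)]

/-- Resampling a block from an independent copy preserves the product measure. -/
theorem map_resample (v : V) :
    ((Measure.infinitePi m).prod (Measure.infinitePi m)).map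
      (fun ω => resample β v ω.1 ω.2) = Measure.infinitePi m := by
  classical
  have hm : Measurable fun ω : (E → Bool) × (E → Bool) => resample β v ω.1 ω.2 := by
    refine measurable_pi_lambda _ fun e => ?_
    by_cases h : β e = v
    · simp only [resample, h, if_true]
      exact (measurable_pi_apply e).comp measurable_snd
    · simp only [resample, h, if_false]
      exact (measurable_pi_apply e).comp measurable_fst
  refine Measure.eq_infinitePi _ fun s t ht => ?_
  rw [Measure.map_apply hm
    (MeasurableSet.pi s.countable_toSet fun _ _ => MeasurableSet.of_discrete)]
  have hpre : (fun ω : (E → Bool) × (E → Bool) => resample β v ω.1 ω.2) ⁻¹' (Set.pi s t) =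
      (Set.pi (s.filter fun e => ¬ β e = v) t) ×ˢ (Set.pi (s.filter fun e => β e = v) t) := by
    ext ω
    simp only [Set.mem_preimage, Set.mem_pi, Set.mem_prod, Finset.coe_filter, Set.mem_ofPred_eq,
      Finset.mem_coe]
    constructor
    · intro h
      refine ⟨fun e he => ?_, fun e he => ?_⟩
      · have := h e he.1
        rwa [resample, if_neg he.2] at this
      · have := h e he.1
        rwa [resample, if_pos he.2] at this
    · intro h e he
      rw [resample]
      split_ifs with hv
      · exact h.2 e ⟨he, hv⟩
      · exact h.1 e ⟨he, hv⟩
  rw [hpre, Measure.prod_prod, Measure.infinitePi_pi _ fun _ _ => MeasurableSet.of_discrete,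
    Measure.infinitePi_pi _ fun _ _ => MeasurableSet.of_discrete, mul_comm,
    Finset.prod_filter_mul_prod_filter_not]

variable [Finite E]

theorem integral_resample (v : V) (g : (E → Bool) → ℝ) :
    ∫ ω, ∫ ω', g (resample β v ω ω') ∂(Measure.infinitePi m) ∂(Measure.infinitePi m) =
      ∫ ω, g ω ∂(Measure.infinitePi m) := by
  conv_rhs => rw [← map_resample (β := β) m v]
  rw [integral_map Measurable.of_discrete.aemeasurable
    Measurable.of_discrete.aestronglyMeasurable, integral_prod _ Integrable.of_finite]

/-- The exponential moment form of the method of bounded differences: if changing the coordinates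
in one block changes `f` by at most `c`, then each block on which `f` depends contributes `c²` to
the variance proxy of `f`. The blocks are averaged out one by one, with Hoeffding's lemma. -/
theorem integral_exp_le_of_bounded_differences {c : ℝ} (hc : 0 ≤ c) (s : ℝ) (S : Finset V) :
    ∀ f : (E → Bool) → ℝ, (∀ v ω ω', (∀ e, β e ≠ v → ω e = ω' e) → |f ω - f ω'| ≤ c) →
      (∀ ω ω', (∀ e, β e ∈ S → ω e = ω' e) → f ω = f ω') →
      ∫ ω, Real.exp (s * f ω) ∂(Measure.infinitePi m) ≤
        Real.exp (s * (∫ ω, f ω ∂(Measure.infinitePi m)) + S.card * (c ^ 2 * s ^ 2 / 2)) := by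
  classical
  set P := Measure.infinitePi m with hP
  induction S using Finset.induction_on with
  | empty =>
    intro f _ hf
    have h : ∀ ω, f ω = f (fun _ => true) := fun ω => hf _ _ (by simp)
    simp [h]
  | insert v S hv ih =>
    intro f hfc hfS
    let g : (E → Bool) → ℝ := fun ω => ∫ ω', f (resample β v ω ω') ∂P
    have hint : ∀ F : (E → Bool) → ℝ, Integrable F P := fun F => Integrable.of_finite
    have hgc : ∀ u ω ω', (∀ e, β e ≠ u → ω e = ω' e) → |g ω - g ω'| ≤ c := by
      intro u ω ω' h
      simp only [g]
      rw [← integral_sub (hint _) (hint _), ← Real.norm_eq_abs]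
      refine (norm_integral_le_of_norm_le_const (C := c)
        (Filter.Eventually.of_forall fun ω'' => ?_)).trans (by simp)
      exact hfc u _ _ fun e he => resample_congr fun _ => h e he
    have hgS : ∀ ω ω', (∀ e, β e ∈ S → ω e = ω' e) → g ω = g ω' := by
      intro ω ω' h
      refine integral_congr_ae (Filter.Eventually.of_forall fun ω'' => hfS _ _ fun e he => ?_)
      refine resample_congr fun hne => h e ?_
      exact (Finset.mem_insert.1 he).resolve_left hne
    have hgf : ∫ ω, g ω ∂P = ∫ ω, f ω ∂P := integral_resample m v f
    have hstep : ∀ ω, ∫ ω', Real.exp (s * f (resample β v ω ω')) ∂P ≤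
        Real.exp (s * g ω) * Real.exp (c ^ 2 * s ^ 2 / 2) := by
      intro ω
      have hsub := hasSubgaussianMGF_of_mem_Icc (μ := P) (a := f ω - c) (b := f ω + c)
        (X := fun ω' => f (resample β v ω ω')) Measurable.of_discrete.aemeasurable
        (Filter.Eventually.of_forall fun ω' => by
          have := abs_le.1 (hfc v (resample β v ω ω') ω fun e he => resample_of_ne he)
          constructor <;> linarith)
      have h1 := hsub.mgf_le s
      have h2 : (((‖f ω + c - (f ω - c)‖₊ / 2) ^ 2 : NNReal) : ℝ) = c ^ 2 := by
        push_cast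
        rw [Real.norm_eq_abs, show f ω + c - (f ω - c) = 2 * c by ring,
          abs_of_nonneg (by positivity)]
        ring
      rw [h2] at h1
      refine le_trans (le_of_eq ?_) (mul_le_mul_of_nonneg_left h1 (Real.exp_pos (s * g ω)).le)
      rw [mgf, ← integral_const_mul]
      refine integral_congr_ae (Filter.Eventually.of_forall fun ω' => ?_)
      simp only [g]
      rw [← Real.exp_add]
      congr 1
      ring
    calc ∫ ω, Real.exp (s * f ω) ∂P
        = ∫ ω, ∫ ω', Real.exp (s * f (resample β v ω ω')) ∂P ∂P :=
          (integral_resample m v fun ω => Real.exp (s * f ω)).symm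
      _ ≤ ∫ ω, Real.exp (s * g ω) * Real.exp (c ^ 2 * s ^ 2 / 2) ∂P :=
          integral_mono (hint _) (hint _) hstep
      _ = (∫ ω, Real.exp (s * g ω) ∂P) * Real.exp (c ^ 2 * s ^ 2 / 2) := integral_mul_const _ _
      _ ≤ Real.exp (s * (∫ ω, g ω ∂P) + S.card * (c ^ 2 * s ^ 2 / 2)) *
          Real.exp (c ^ 2 * s ^ 2 / 2) :=
          mul_le_mul_of_nonneg_right (ih g hgc hgS) (Real.exp_pos _).le
      _ = _ := by
          rw [hgf, ← Real.exp_add, Finset.card_insert_of_notMem hv]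
          congr 1
          push_cast
          ring

theorem hasSubgaussianMGF_of_bounded_differences [Fintype V] {c : ℝ} (hc : 0 ≤ c)
    {f : (E → Bool) → ℝ} (hf : ∀ v ω ω', (∀ e, β e ≠ v → ω e = ω' e) → |f ω - f ω'| ≤ c) :
    HasSubgaussianMGF (fun ω => f ω - ∫ ω, f ω ∂(Measure.infinitePi m))
      (Real.toNNReal (Fintype.card V * c ^ 2)) (Measure.infinitePi m) := by
  refine ⟨fun _ => Integrable.of_finite, fun s => ?_⟩
  have h := integral_exp_le_of_bounded_differences m hc s Finset.univ f hf
    (fun ω ω' h => congrArg f (funext fun e => h e (Finset.mem_univ _)))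
  rw [mgf]
  simp only [mul_sub, Real.exp_sub]
  rw [integral_div, div_le_iff₀ (Real.exp_pos _), ← Real.exp_add]
  refine h.trans (le_of_eq ?_)
  rw [Finset.card_univ, Real.coe_toNNReal _ (by positivity)]
  congr 1
  ring

/-- Two-sided bounded differences inequality. -/
theorem measureReal_abs_sub_le_of_bounded_differences [Fintype V] {c : ℝ} (hc : 0 ≤ c)
    {f : (E → Bool) → ℝ} (hf : ∀ v ω ω', (∀ e, β e ≠ v → ω e = ω' e) → |f ω - f ω'| ≤ c)
    {t : ℝ} (ht : 0 ≤ t) :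
    1 - 2 * Real.exp (-t ^ 2 / (2 * (Fintype.card V * c ^ 2))) ≤
      (Measure.infinitePi m).real {ω | |f ω - ∫ ω, f ω ∂(Measure.infinitePi m)| ≤ t} := by
  set P := Measure.infinitePi m
  have hsub := hasSubgaussianMGF_of_bounded_differences m hc hf
  have h1 := hsub.measure_ge_le ht
  have h2 := hsub.neg.measure_ge_le ht
  rw [Real.coe_toNNReal _ (by positivity)] at h1 h2
  simp only [Pi.neg_apply] at h2
  have hcompl := probReal_compl_eq_one_sub (μ := P)
    (s := {ω | |f ω - ∫ ω, f ω ∂P| ≤ t}) MeasurableSet.of_discrete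
  have hle : P.real {ω | |f ω - ∫ ω, f ω ∂P| ≤ t}ᶜ ≤
      P.real {ω | t ≤ f ω - ∫ ω, f ω ∂P} + P.real {ω | t ≤ -(f ω - ∫ ω, f ω ∂P)} := by
    refine (measureReal_mono fun ω hω => ?_).trans (measureReal_union_le _ _)
    have hω : t < |f ω - ∫ ω, f ω ∂P| := not_le.1 hω
    rcases lt_abs.1 hω with h | h
    · exact Or.inl h.le
    · exact Or.inr h.le
  linarith

end Concentration

/-! ### Comparison of the expectations and conclusion -/

theorem enorm_integral_le_supNorm {μ : Measure ℝ} [IsProbabilityMeasure μ] (φ : ℝ → ℝ) :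
    ‖∫ s, φ s ∂μ‖ₑ ≤ supNorm φ := by
  refine (enorm_integral_le_lintegral_enorm _).trans ?_
  refine (lintegral_mono fun s => le_iSup (fun x => ‖φ x‖ₑ) s).trans ?_
  simp [supNorm]

section Expectation

variable {V W : Type*} [Fintype V] {G : SimpleGraph V} {Γ : SimpleGraph W}
  [G.LocallyFinite] [Γ.LocallyFinite] {o : W} {p : unitInterval} {d h : ℕ} {φ : ℝ → ℝ}

/-- At a vertex whose ball of radius `h` is that of `Γ`, polynomials of degree at most `2 h` have
the same expected integrals, so that the expected integrals of `φ` differ by at most twice the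
distance of `φ` to these polynomials. -/
theorem abs_integral_vertexMeasure_sub_le {v : V} (hiso : RootedBallIso G v Γ o h)
    (hG : ∀ y, G.degree y ≤ d) (hΓ : ∀ y, Γ.degree y ≤ d) (hφ : Continuous φ)
    {P : Polynomial ℝ} (hP : P.natDegree ≤ 2 * h) {ε : ℝ}
    (hPφ : ∀ x ∈ Set.Icc (-(d : ℝ)) d, |φ x - P.eval x| ≤ ε) :
    |(∫ ω, ∫ s, φ s ∂(vertexMeasure (perc G ω) v) ∂(percMeasure G p)) -
      ∫ s, φ s ∂(expectedSpectralMeasure Γ p o)| ≤ 2 * ε := by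
  obtain ⟨hprob, hae, hmom⟩ := expectedSpectralMeasure_spec p hΓ o
  have hprobG : ∀ ω, IsProbabilityMeasure (vertexMeasure (perc G ω) v) := fun ω =>
    isProbabilityMeasure_vertexMeasure _ v
  have haeG : ∀ ω, ∀ᵐ s ∂(vertexMeasure (perc G ω) v), |s| ≤ (d : ℝ) := fun ω =>
    (isSpectralMeasure_vertexMeasure (perc G ω) v).ae_abs_le
      fun y => (degree_perc_le ω y).trans (hG y)
  have hint : ∀ F : (G.edgeSet → Bool) → ℝ, Integrable F (percMeasure G p) := fun F =>
    Integrable.of_finite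
  have hN : P.natDegree < 2 * h + 1 := by omega
  have hpoly : ∫ ω, ∫ s, P.eval s ∂(vertexMeasure (perc G ω) v) ∂(percMeasure G p) =
      ∫ s, P.eval s ∂(expectedSpectralMeasure Γ p o) := by
    rw [integral_polynomial_eq_sum hae P hN]
    simp only [fun ω => integral_polynomial_eq_sum (haeG ω) P hN, integral_pow_vertexMeasure]
    rw [integral_finsetSum _ fun i _ => hint _]
    refine Finset.sum_congr rfl fun i hi => ?_
    have := Finset.mem_range.1 hi
    rw [integral_const_mul, hmom, hiso.integral_walkCount_eq p (by omega)]
  have h1 := abs_integral_sub_integral_polynomial_le hae hφ hPφ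
  have h2 : |(∫ ω, ∫ s, φ s ∂(vertexMeasure (perc G ω) v) ∂(percMeasure G p)) -
      ∫ ω, ∫ s, P.eval s ∂(vertexMeasure (perc G ω) v) ∂(percMeasure G p)| ≤ ε := by
    rw [← integral_sub (hint _) (hint _), ← Real.norm_eq_abs]
    refine (norm_integral_le_of_norm_le_const (C := ε)
      (Filter.Eventually.of_forall fun ω => ?_)).trans (by simp)
    exact abs_integral_sub_integral_polynomial_le (haeG ω) hφ hPφ
  rw [hpoly] at h2
  rw [abs_le] at *
  constructor <;> linarith

theorem ofReal_abs_integral_sub_le [Nonempty V] (hG : ∀ y, G.degree y ≤ d)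
    (hΓ : IsVertexTransitive Γ) {k : ℕ} (hk1 : 1 ≤ k) (hk2 : k ≤ 2 * h) (hφ : ContDiff ℝ k φ) :
    ENNReal.ofReal
        |(∫ ω, ∫ s, φ s ∂(empiricalSpectralMeasure (perc G ω)) ∂(percMeasure G p)) -
          ∫ s, φ s ∂(expectedSpectralMeasure Γ p o)| ≤
      2 * ((badCount G Γ o h : ℝ≥0∞) / (Fintype.card V : ℝ≥0∞)) * supNorm φ +
        2 * ENNReal.ofReal (Real.pi / 2 * d) ^ k *
          ENNReal.ofReal ((Nat.factorial (2 * h - k + 1) : ℝ) / Nat.factorial (2 * h + 1)) *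
          supNorm (iteratedDeriv k φ) := by
  classical
  set X : ℝ≥0∞ := 2 * ENNReal.ofReal (Real.pi / 2 * d) ^ k *
    ENNReal.ofReal ((Nat.factorial (2 * h - k + 1) : ℝ) / Nat.factorial (2 * h + 1)) *
      supNorm (iteratedDeriv k φ)
  set b : ℝ := ∫ s, φ s ∂(expectedSpectralMeasure Γ p o)
  let a : V → ℝ := fun v => ∫ ω, ∫ s, φ s ∂(vertexMeasure (perc G ω) v) ∂(percMeasure G p)
  have hn : (Fintype.card V : ℝ) ≠ 0 := by exact_mod_cast Fintype.card_ne_zero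
  have hn' : (Fintype.card V : ℝ≥0∞) ≠ 0 := by exact_mod_cast Fintype.card_ne_zero
  have hgood : ∀ v, RootedBallIso G v Γ o h → ENNReal.ofReal |a v - b| ≤ X := by
    intro v hiso
    have hΓd : ∀ y, Γ.degree y ≤ d := fun y => by
      rw [hΓ.degree_eq y o]
      exact (hiso.degree_le (by omega)).trans (hG v)
    obtain ⟨x₀, -, hx₀⟩ := (isCompact_Icc (a := -(d : ℝ)) (b := d)).exists_isMaxOn
      ⟨0, by simp⟩ (hφ.continuous_iteratedDeriv k le_rfl).abs.continuousOn
    obtain ⟨P, hP, hPφ⟩ := exists_polynomial_near_of_iteratedDeriv_le (D := d)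
      (Nat.cast_nonneg d) k hφ hk2 fun x hx => hx₀ hx
    refine (ENNReal.ofReal_le_ofReal (abs_integral_vertexMeasure_sub_le hiso hG hΓd
      hφ.continuous hP hPφ)).trans ?_
    rw [ENNReal.ofReal_mul (by norm_num), ENNReal.ofReal_mul (by positivity),
      ENNReal.ofReal_mul (by positivity), ENNReal.ofReal_pow (by positivity),
      ENNReal.ofReal_ofNat, ← mul_assoc, ← mul_assoc, ← Real.enorm_eq_ofReal_abs]
    exact mul_le_mul_right (le_iSup (fun x => ‖iteratedDeriv k φ x‖ₑ) x₀) _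
  have hbad : ∀ v, ENNReal.ofReal |a v - b| ≤ 2 * supNorm φ := by
    intro v
    have := (expectedSpectralMeasure_spec p (fun y => (hΓ.degree_eq y o).le) o).1
    have hv : ∀ ω, IsProbabilityMeasure (vertexMeasure (perc G ω) v) := fun ω =>
      isProbabilityMeasure_vertexMeasure _ v
    have h1 : ‖a v‖ₑ ≤ supNorm φ := by
      refine (enorm_integral_le_lintegral_enorm _).trans ?_
      refine (lintegral_mono fun ω => enorm_integral_le_supNorm φ).trans ?_
      simp
    rw [← Real.enorm_eq_ofReal_abs, two_mul]
    exact enorm_sub_le.trans (add_le_add h1 (enorm_integral_le_supNorm φ))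
  have hE : (∫ ω, ∫ s, φ s ∂(empiricalSpectralMeasure (perc G ω)) ∂(percMeasure G p)) - b =
      (Fintype.card V : ℝ)⁻¹ * ∑ v, (a v - b) := by
    simp only [integral_empiricalSpectralMeasure_eq_average]
    rw [integral_const_mul, integral_finsetSum _ fun v _ => Integrable.of_finite,
      Finset.sum_sub_distrib, Finset.sum_const, Finset.card_univ, nsmul_eq_mul, mul_sub,
      inv_mul_cancel_left₀ hn]
  have hcount : (badCount G Γ o h : ℝ≥0∞) =
      ((Finset.univ.filter fun v => ¬ RootedBallIso G v Γ o h).card : ℝ≥0∞) := by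
    rw [badCount, Set.ncard_eq_toFinset_card']
    congr 2
    ext v
    simp
  rw [hE, abs_mul, abs_of_nonneg (by positivity), ENNReal.ofReal_mul (by positivity),
    ENNReal.ofReal_inv_of_pos (by positivity), ENNReal.ofReal_natCast]
  calc (Fintype.card V : ℝ≥0∞)⁻¹ * ENNReal.ofReal |∑ v, (a v - b)|
      ≤ (Fintype.card V : ℝ≥0∞)⁻¹ * ∑ v,
          ((if ¬ RootedBallIso G v Γ o h then 2 * supNorm φ else 0) + X) := by
        gcongr
        refine (ENNReal.ofReal_le_ofReal (Finset.abs_sum_le_sum_abs _ _)).trans ?_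
        rw [ENNReal.ofReal_sum_of_nonneg fun v _ => abs_nonneg _]
        refine Finset.sum_le_sum fun v _ => ?_
        by_cases hv : RootedBallIso G v Γ o h
        · simpa [hv] using hgood v hv
        · rw [if_pos hv]
          exact (hbad v).trans le_self_add
    _ = _ := by
        rw [Finset.sum_add_distrib, ← Finset.sum_filter, Finset.sum_const, Finset.sum_const,
          Finset.card_univ, nsmul_eq_mul, nsmul_eq_mul, ← hcount, mul_add,
          ENNReal.inv_mul_cancel_left hn' (ENNReal.natCast_ne_top _), ENNReal.div_eq_inv_mul]
        congr 1
        ring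

end Expectation

section Fluctuation

variable {V : Type*} [Fintype V] {G : SimpleGraph V} {p : unitInterval} {φ : ℝ → ℝ}

theorem eq_const_of_tvNorm_eq_zero (hφ : ContDiff ℝ 1 φ) (hφ' : Integrable (deriv φ))
    (h : tvNorm φ = 0) (x : ℝ) : φ x = φ 0 := by
  have h1 : (fun x => |deriv φ x|) =ᵐ[volume] 0 :=
    (integral_eq_zero_iff_of_nonneg (fun x => abs_nonneg _) hφ'.abs).1 h
  have h2 := (Continuous.ae_eq_iff_eq volume (hφ.continuous_deriv le_rfl).abs
    continuous_const).1 h1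
  exact is_const_of_deriv_eq_zero (hφ.differentiable (by norm_num))
    (fun y => abs_eq_zero.1 (congrFun h2 y)) x 0

/-- Concentration of the integral of `φ` against the empirical measure: each edge is attributed to
one of its endpoints, and the edges attributed to the same vertex form a block. -/
theorem measureReal_abs_integral_sub_le [Nonempty V] (hφ : ContDiff ℝ 1 φ)
    (hφ' : Integrable (deriv φ)) (htv : tvNorm φ ≠ 0) {t : ℝ} (ht : 0 ≤ t) :
    1 - 2 * Real.exp (-((Fintype.card V : ℝ) * t ^ 2 / (2 * tvNorm φ ^ 2))) ≤
      (percMeasure G p).real {ω | |(∫ s, φ s ∂(empiricalSpectralMeasure (perc G ω))) -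
        ∫ ω, ∫ s, φ s ∂(empiricalSpectralMeasure (perc G ω)) ∂(percMeasure G p)| ≤ t} := by
  have hn : (Fintype.card V : ℝ) ≠ 0 := by exact_mod_cast Fintype.card_ne_zero
  have htv0 : 0 ≤ tvNorm φ := integral_nonneg fun x => abs_nonneg _
  have h := measureReal_abs_sub_le_of_bounded_differences (V := V)
    (β := fun e : G.edgeSet => e.1.out.1) (fun _ => bernoulliMeasure true false p)
    (c := tvNorm φ / Fintype.card V) (by positivity)
    (f := fun ω => ∫ s, φ s ∂(empiricalSpectralMeasure (perc G ω))) (fun v ω ω' hω =>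
      abs_integral_empirical_sub_le hφ hφ' (v := v) fun x y hx hy => by
        have he : ∀ hxy : s(x, y) ∈ G.edgeSet, ω ⟨s(x, y), hxy⟩ = ω' ⟨s(x, y), hxy⟩ := by
          intro hxy
          refine hω _ fun hv => ?_
          have hmem := Sym2.out_fst_mem s(x, y)
          rw [show (Quot.out s(x, y)).1 = v from hv, Sym2.mem_iff] at hmem
          rcases hmem with rfl | rfl
          · exact hx rfl
          · exact hy rfl
        exact ⟨fun ⟨h1, h2⟩ => ⟨h1, (he h1).symm.trans h2⟩,
          fun ⟨h1, h2⟩ => ⟨h1, (he h1).trans h2⟩⟩) ht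
  have e : -t ^ 2 / (2 * ((Fintype.card V : ℝ) * (tvNorm φ / Fintype.card V) ^ 2)) =
      -((Fintype.card V : ℝ) * t ^ 2 / (2 * tvNorm φ ^ 2)) := by
    field_simp
  rw [e] at h
  exact h

end Fluctuation

end QuantumPercolation

theorem theorem3 {V W : Type*} [Fintype V] [Nonempty V]
    (G : SimpleGraph V) [DecidableRel G.Adj] (d : ℕ) (hd : G.maxDegree = d)
    (Γ : SimpleGraph W) [Γ.LocallyFinite] (hΓ : QuantumPercolation.IsVertexTransitive Γ) (o : W)
    (p : unitInterval) (h k : ℕ) (hk1 : 1 ≤ k) (hk2 : k ≤ 2 * h)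
    (φ : ℝ → ℝ) (hφ : ContDiff ℝ k φ) (hφ' : MeasureTheory.Integrable (deriv φ))
    (t : ℝ) (ht : 0 ≤ t) :
    MeasureTheory.IsProbabilityMeasure (QuantumPercolation.expectedSpectralMeasure Γ p o) ∧
    (if QuantumPercolation.tvNorm φ = 0 then 1 else
      1 - 2 * Real.exp (-((Fintype.card V : ℝ) * t ^ 2 /
        (8 * QuantumPercolation.tvNorm φ ^ 2)))) ≤
    (QuantumPercolation.percMeasure G p).real
      {ω | ENNReal.ofReal
          |(∫ x, φ x ∂QuantumPercolation.empiricalSpectralMeasure (QuantumPercolation.perc G ω)) -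
            ∫ x, φ x ∂QuantumPercolation.expectedSpectralMeasure Γ p o| ≤
        ENNReal.ofReal t +
        2 * ((QuantumPercolation.badCount G Γ o h : ℝ≥0∞) / (Fintype.card V : ℝ≥0∞)) *
          QuantumPercolation.supNorm φ +
        2 * ENNReal.ofReal (Real.pi / 2 * d) ^ k *
          ENNReal.ofReal ((Nat.factorial (2 * h - k + 1) : ℝ) / Nat.factorial (2 * h + 1)) *
          QuantumPercolation.supNorm (iteratedDeriv k φ)} := by
  open QuantumPercolation in
  have hprob := (expectedSpectralMeasure_spec p (fun y => (hΓ.degree_eq y o).le) o).1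
  refine ⟨hprob, ?_⟩
  have hφ1 : ContDiff ℝ 1 φ := hφ.of_le (by exact_mod_cast hk1)
  split_ifs with htv
  · -- `φ` is constant
    have hconst := eq_const_of_tvNorm_eq_zero hφ1 hφ' htv
    refine (probReal_univ (μ := percMeasure G p)).symm.le.trans
      (measureReal_mono fun ω _ => ?_)
    have h1 : ∫ x, φ x ∂(empiricalSpectralMeasure (perc G ω)) = φ 0 := by
      classical
      rw [integral_empiricalSpectralMeasure]
      simp [hconst]
    have h2 : ∫ x, φ x ∂(expectedSpectralMeasure Γ p o) = φ 0 := by simp [hconst]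
    change ENNReal.ofReal |_ - _| ≤ _
    rw [h1, h2, sub_self, abs_zero, ENNReal.ofReal_zero]
    exact zero_le
  · have hpos : 0 < tvNorm φ := lt_of_le_of_ne (integral_nonneg fun x => abs_nonneg _) (Ne.symm htv)
    have hconc := measureReal_abs_integral_sub_le (G := G) (p := p) hφ1 hφ' htv ht
    have hexp : Real.exp (-((Fintype.card V : ℝ) * t ^ 2 / (2 * tvNorm φ ^ 2))) ≤
        Real.exp (-((Fintype.card V : ℝ) * t ^ 2 / (8 * tvNorm φ ^ 2))) := by
      gcongr
      norm_num
    refine le_trans (by linarith) (hconc.trans (measureReal_mono fun ω hω => ?_))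
    have hmean := ofReal_abs_integral_sub_le (o := o) (p := p)
      (fun y => (G.degree_le_maxDegree y).trans hd.le) hΓ hk1 hk2 hφ
    change ENNReal.ofReal |_ - _| ≤ _
    rw [add_assoc]
    refine le_trans ?_ (add_le_add (ENNReal.ofReal_le_ofReal hω) hmean)
    rw [← ENNReal.ofReal_add (abs_nonneg _) (abs_nonneg _)]
    exact ENNReal.ofReal_le_ofReal (abs_sub_le _ _ _)
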